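/- Let $a,b,k,\lambda\in\mathbb R$ be constants and put $P=1-k(x^2+y^2)$. Let $\Omega\subseteq\mathbb R^3$ be an open set of points $(u,x,y)$ on which $P\neq0$, and let $H=H(u,x,y)$ and $\phi=\phi(u,x,y)$ be smooth functions on $\Omega$. On $M=\{(u,r,x,y): (u,x,y)\in\Omega,\ r\in\mathbb R\}$ consider the Kundt metric $$ds^2=2\,du\,\bigl[dr+(\lambda r^2+H(u,x,y))\,du\bigr]+P^{-2}(dx^2+dy^2)$$ and the 2-form $$F=a\,du\wedge dr+b\,\mathbf V_2+du\wedge d\phi,\qquad \mathbf V_2=P^{-2}\,dx\wedge dy .$$ Assume that $\Box_2\phi=0$ on $\Omega$, where $\Box_2=-{*_2}d_2{*_2}d_2$ is the Laplacian of the transverse metric $P^{-2}(dx^2+dy^2)$, acting at fixed $u$. Then $F$ is universal, that is, $dF=0$ and $${*}\,d\,{*}\tilde F=0$$ for every 2-form $\tilde F$ on $M$ that is constructed polynomially from $F$, its Hodge dual and their covariant derivatives of arbitrary order. Here the tensors constructed polynomially from these are all those obtained from $F$, the metric and the Levi-Civita tensor $\epsilon_{abcd}$ by finitely many covariant derivatives,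 tensor products, metric contractions, permutations of indices and linear combinations; the scalar coefficients may be arbitrary smooth functions of scalar invariants constructed in the same way (in particular real constants), where a coefficient function need only be defined and smooth on an open set containing the values taken by the invariants on $M$. -/

import Mathlib

open scoped ContDiff

noncomputable section

namespace EMField

/-- Covariant tensor fields of rank `k` in a coordinate chart of `ℝⁿ`, given by their components:
`T x a` is the component `T_{a₀ … a_{k-1}}` at the point `x`. Only the values on the chart domain
(an open set, supplied separately) are meaningful. -/
abbrev TensorField (n k : ℕ) : Type := (Fin n → ℝ) → (Fin k → Fin n) → ℝ

/-- The components `g_{ab}` of a metric in a coordinate chart. -/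
abbrev MetricField (n : ℕ) : Type := (Fin n → ℝ) → Matrix (Fin n) (Fin n) ℝ

variable {n : ℕ}

/-- The partial derivative `∂_i f` at `x`. -/
def pd (i : Fin n) (f : (Fin n → ℝ) → ℝ) (x : Fin n → ℝ) : ℝ :=
  fderiv ℝ f x (Pi.single i 1)

/-- The Christoffel symbols
`Γ^c_{ab} = (1/2) g^{cd} (∂_a g_{db} + ∂_b g_{da} - ∂_d g_{ab})` of the Levi-Civita connection. -/
def christoffel (g : MetricField n) (x : Fin n → ℝ) (c a b : Fin n) : ℝ :=
  (1 / 2) * ∑ d, (g x)⁻¹ c d *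
    (pd a (fun y => g y d b) x + pd b (fun y => g y d a) x - pd d (fun y => g y a b) x)

/-- The covariant derivative; the index of differentiation is put first:
`(∇T)_{b a₀ … a_{k-1}} = ∂_b T_{a₀ … a_{k-1}} - ∑_j Γ^c_{b a_j} T_{a₀ … c … a_{k-1}}`. -/
def covDeriv (g : MetricField n) {k : ℕ} (T : TensorField n k) : TensorField n (k + 1) :=
  fun x a => pd (a 0) (fun y => T y (Fin.tail a)) x -
    ∑ j : Fin k, ∑ c : Fin n,
      christoffel g x c (a 0) (Fin.tail a j) * T x (Function.update (Fin.tail a) j c)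

/-- The metric as a tensor field of rank 2. -/
def metricTensor (g : MetricField n) : TensorField n 2 := fun x a => g x (a 0) (a 1)

/-- The Levi-Civita tensor (metric volume form) `ε_{a₀ … a_{n-1}}` for the orientation given by the
order of the coordinates: `√|det g|` times the Levi-Civita symbol. -/
def volumeTensor (g : MetricField n) : TensorField n n :=
  fun x a => √|(g x).det| * (Matrix.of fun i j : Fin n => if a i = j then (1 : ℝ) else 0).det

/-- The tensor product. -/
def tensorMul {k l : ℕ} (T : TensorField n k) (S : TensorField n l) : TensorField n (k + l) :=
  fun x a => T x (fun i => a (Fin.castAdd l i)) * S x (fun j => a (Fin.natAdd k j))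

/-- The metric contraction `g^{cd} T_{c d a₀ … a_{k-1}}` of the first two indices. -/
def contract (g : MetricField n) {k : ℕ} (T : TensorField n (k + 2)) : TensorField n k :=
  fun x a => ∑ c : Fin n, ∑ d : Fin n, (g x)⁻¹ c d * T x (Fin.cons c (Fin.cons d a))

/-- `T` is totally antisymmetric on `M`, i.e. it is a differential form there. -/
def IsForm (M : Set (Fin n → ℝ)) {k : ℕ} (T : TensorField n k) : Prop :=
  ∀ x ∈ M, ∀ (σ : Equiv.Perm (Fin k)) (a : Fin k → Fin n),
    T x (a ∘ σ) = ((Equiv.Perm.sign σ : ℤ) : ℝ) * T x a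

/-- The exterior derivative
`(dA)_{a₀ … a_k} = ∑_i (-1)^i ∂_{a_i} A_{a₀ … a_{i-1} a_{i+1} … a_k}`. -/
def extD {k : ℕ} (A : TensorField n k) : TensorField n (k + 1) :=
  fun x a => ∑ i : Fin (k + 1),
    (-1) ^ (i : ℕ) * pd (a i) (fun y => A y (fun j => a (i.succAbove j))) x

/-- The Hodge dual of a `p`-form in dimension `n = p + q`:
`(*A)_{b₁ … b_q} = (1/p!) ε^{a₁ … a_p}_{b₁ … b_q} A_{a₁ … a_p}`. -/
def hodge {p q : ℕ} (h : p + q = n) (g : MetricField n) (A : TensorField n p) :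
    TensorField n q :=
  fun x b => (1 / (p.factorial : ℝ)) * ∑ a : Fin p → Fin n, ∑ c : Fin p → Fin n,
    (∏ i, (g x)⁻¹ (a i) (c i)) *
      volumeTensor g x (fun i => Fin.append c b (Fin.cast h.symm i)) * A x a

/-- The tensor fields on `M` constructed polynomially from `F`, its Hodge dual and their covariant
derivatives: all those obtained from `F`, the metric and the Levi-Civita tensor by covariant
differentiation, tensor products, metric contractions, relabelling of indices and linear
combinations. The scalar coefficients are smooth functions of scalar invariants, which are
rank-zero tensor fields constructed in the same way (no invariants: a real constant); a
coefficient function needs to be smooth only on an open set that contains the values taken by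
the invariants on `M`. -/
inductive Constructed (g : MetricField n) (M : Set (Fin n → ℝ)) {p : ℕ} (F : TensorField n p) :
    ∀ {k : ℕ}, TensorField n k → Prop
  | field : Constructed g M F F
  | metric : Constructed g M F (metricTensor g)
  | volume : Constructed g M F (volumeTensor g)
  | cov {k : ℕ} {T : TensorField n k} :
      Constructed g M F T → Constructed g M F (covDeriv g T)
  | mul {k l : ℕ} {T : TensorField n k} {S : TensorField n l} :
      Constructed g M F T → Constructed g M F S → Constructed g M F (tensorMul T S)
  | contr {k : ℕ} {T : TensorField n (k + 2)} :
      Constructed g M F T → Constructed g M F (contract g T)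
  | relabel {k l : ℕ} (σ : Fin k ≃ Fin l) {T : TensorField n k} :
      Constructed g M F T → Constructed g M F (fun x (a : Fin l → Fin n) => T x (a ∘ σ))
  | add {k : ℕ} {T S : TensorField n k} :
      Constructed g M F T → Constructed g M F S →
        Constructed g M F (fun x (a : Fin k → Fin n) => T x a + S x a)
  | coeff {m k : ℕ} (I : Fin m → TensorField n 0) (V : Set (Fin m → ℝ)) (f : (Fin m → ℝ) → ℝ)
      {T : TensorField n k} :
      (∀ i, Constructed g M F (I i)) → IsOpen V → ContDiffOn ℝ ∞ f V →
      (∀ x ∈ M, (fun i => I i x Fin.elim0) ∈ V) → Constructed g M F T →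
        Constructed g M F (fun x (a : Fin k → Fin n) => f (fun i => I i x Fin.elim0) * T x a)

/-- A `(p+1)`-form `F` on the domain `M` of an `n`-dimensional metric `g`, `n = p + 1 + q`, is
universal if `dF = 0` and `*d*T = 0` for all `(p+1)`-forms `T` constructed polynomially
from `F` and its covariant derivatives. -/
def IsUniversal {p q : ℕ} (h : p + 1 + q = n) (g : MetricField n) (M : Set (Fin n → ℝ))
    (F : TensorField n (p + 1)) : Prop :=
  IsForm M F ∧
  (∀ x ∈ M, ∀ a, extD F x a = 0) ∧
  ∀ T : TensorField n (p + 1), Constructed g M F T → IsForm M T →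
    ∀ x ∈ M, ∀ b : Fin p → Fin n,
      hodge (show q + 1 + p = n by omega) g (extD (hodge h g T)) x b = 0

/-- A function as a tensor field of rank 0. -/
def scalarField (f : (Fin n → ℝ) → ℝ) : TensorField n 0 := fun x _ => f x

/-- The coordinate one-form `dx^i`. -/
def coordForm (i : Fin n) : TensorField n 1 := fun _ a => if a 0 = i then 1 else 0

/-- The wedge product of two one-forms, `(α ∧ β)_{ab} = α_a β_b - α_b β_a`. -/
def wedge (α β : TensorField n 1) : TensorField n 2 :=
  fun x a => α x ![a 0] * β x ![a 1] - α x ![a 1] * β x ![a 0]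

/-- The function `P = 1 - k (x² + y²)`. -/
def kundtP (k x y : ℝ) : ℝ := 1 - k * (x ^ 2 + y ^ 2)

/-- The transverse metric `P⁻² (dx² + dy²)`, coordinates `(x, y)`. -/
def transverseMetric (k : ℝ) : MetricField 2 := fun z =>
  !![((kundtP k (z 0) (z 1)) ^ 2)⁻¹, 0;
     0, ((kundtP k (z 0) (z 1)) ^ 2)⁻¹]

/-- The transverse Laplacian `□₂ f = - *₂ d₂ *₂ d₂ f` on functions of `(x, y)`. -/
def transverseBox (k : ℝ) (f : (Fin 2 → ℝ) → ℝ) (z : Fin 2 → ℝ) : ℝ :=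
  -hodge (show 2 + 0 = 2 from rfl) (transverseMetric k)
    (extD (hodge (show 1 + 1 = 2 from rfl) (transverseMetric k)
      (extD (scalarField f)))) z Fin.elim0

/-- The metric `2 du [dr + (λ r² + H(u,x,y)) du] + P⁻² (dx² + dy²)`,
coordinates `(u, r, x, y)`; `l` stands for `λ`. -/
def kundtMetric (l k : ℝ) (H : ℝ × ℝ × ℝ → ℝ) : MetricField 4 := fun z =>
  !![2 * (l * (z 1) ^ 2 + H (z 0, z 2, z 3)), 1, 0, 0;
     1, 0, 0, 0;
     0, 0, ((kundtP k (z 2) (z 3)) ^ 2)⁻¹, 0;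
     0, 0, 0, ((kundtP k (z 2) (z 3)) ^ 2)⁻¹]

/-- The domain of the coordinates `(u, r, x, y)`: `r` is arbitrary and `(u, x, y) ∈ Ω`. -/
def kundtDomain (Ω : Set (ℝ × ℝ × ℝ)) : Set (Fin 4 → ℝ) := {z | (z 0, z 2, z 3) ∈ Ω}

/-- The 2-form `F = a du ∧ dr + b P⁻² dx ∧ dy + du ∧ dφ`, `φ = φ(u,x,y)`. -/
def kundtForm (a b k : ℝ) (φ : ℝ × ℝ × ℝ → ℝ) : TensorField 4 2 := fun z i =>
  a * wedge (coordForm 0) (coordForm 1) z i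
    + b * (((kundtP k (z 2) (z 3)) ^ 2)⁻¹ * wedge (coordForm 2) (coordForm 3) z i)
    + wedge (coordForm 0) (extD (scalarField fun w => φ (w 0, w 2, w 3))) z i

end EMField

end

/-!
The proof rests on the null frame `∂_u - (λ r² + H) ∂_r`, `∂_r`, `P (∂_x ∓ i ∂_y)`, in which each
component of a tensor has a level (minus its boost weight) and a spin weight, both additive under
tensor products and zero for the metric and the volume form. Let `Φ s` be the `s`-fold spin-weighted
derivative of `φ` (complex conjugate for `s < 0`), and `Φ 0 = 0`. A component of level `b` and spin
weight `s` is called admissible (`Adm`) if it vanishes for `b < 0`, is a constant (zero unless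
`s = 0`) for `b = 0`, and for `b > 0` is a polynomial in `r` of degree at most `b - 1` whose coefficient
of `r ^ (b - 1)` is a constant multiple of `Φ s`. The lower coefficients may be arbitrary smooth
functions of `(u, x, y)`, and this is where `H` and all products of derivatives of `φ` end up.

Tensors with admissible components (`Balanced`) form a class that contains `F`, the metric and the
volume form and that is closed under all operations of the construction (`Constructed.balanced`).
For products this is a count of degrees. For covariant derivatives (`Balanced.covDeriv`), the
derivative along `∂_r` lowers degree and level together, the derivative along the first frame vector
raises both by one (`Adm.boostD`), the remaining connection coefficients, which are derivatives of
`H`, raise the level by two but do not involve `r`, and the transverse derivatives raise or lower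
the spin weight. For the last step the family `Φ` has to be closed under these operators up to
constants (`eth_potentials`): the transverse metric has constant curvature, so that their commutator
is a multiple of the spin weight (`eth_comm`), and the lowering operator annihilates `Φ 1` because
`φ` is harmonic. Scalars in the class are constants, so coefficient functions are harmless.

A two-form in the class is `α du ∧ dr + β P⁻² dx ∧ dy + du ∧ ω`, where `α`, `β` are constants and
`ω` is a combination with constant coefficients of `dφ` and its transverse dual, hence closed
(`Balanced.extD_eq_zero`). The class is closed under the Hodge dual as well, so that `F` and every
`*T` are closed.
-/

noncomputable section

namespace EMField

/-! ### Partial derivatives of complex-valued functions -/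

/-- The partial derivative `∂_i f` of a complex-valued function at `z`. -/
def cpd (i : Fin 4) (f : (Fin 4 → ℝ) → ℂ) (z : Fin 4 → ℝ) : ℂ :=
  fderiv ℝ f z (Pi.single i 1)

section Calculus

variable {M : Set (Fin 4 → ℝ)} {f g : (Fin 4 → ℝ) → ℂ} {z : Fin 4 → ℝ}

theorem cpd_add (i : Fin 4) (hf : DifferentiableAt ℝ f z) (hg : DifferentiableAt ℝ g z) :
    cpd i (fun w => f w + g w) z = cpd i f z + cpd i g z := by
  simp [cpd, fderiv_fun_add hf hg]

theorem cpd_sub (i : Fin 4) (hf : DifferentiableAt ℝ f z) (hg : DifferentiableAt ℝ g z) :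
    cpd i (fun w => f w - g w) z = cpd i f z - cpd i g z := by
  simp [cpd, fderiv_fun_sub hf hg]

theorem cpd_mul (i : Fin 4) (hf : DifferentiableAt ℝ f z) (hg : DifferentiableAt ℝ g z) :
    cpd i (fun w => f w * g w) z = cpd i f z * g z + f z * cpd i g z := by
  simp [cpd, fderiv_fun_mul hf hg]; ring

theorem cpd_const (i : Fin 4) (c : ℂ) : cpd i (fun _ => c) z = 0 := by
  simp [cpd]

theorem cpd_const_mul (i : Fin 4) (c : ℂ) (hf : DifferentiableAt ℝ f z) :
    cpd i (fun w => c * f w) z = c * cpd i f z := by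
  rw [cpd_mul i (differentiableAt_const c) hf, cpd_const]; ring

theorem cpd_congr (hM : IsOpen M) (hz : z ∈ M) (h : ∀ w ∈ M, f w = g w) (i : Fin 4) :
    cpd i f z = cpd i g z := by
  have : f =ᶠ[nhds z] g := Filter.eventually_of_mem (hM.mem_nhds hz) h
  simp [cpd, this.fderiv_eq]

theorem cpd_ofReal (i : Fin 4) {f : (Fin 4 → ℝ) → ℝ} (hf : DifferentiableAt ℝ f z) :
    cpd i (fun w => (f w : ℂ)) z = (pd i f z : ℂ) := by
  have h := (Complex.ofRealCLM.hasFDerivAt (x := f z)).comp z hf.hasFDerivAt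
  have h' : HasFDerivAt (fun w => (f w : ℂ)) (Complex.ofRealCLM.comp (fderiv ℝ f z)) z := h
  simp [cpd, pd, h'.fderiv]

theorem cpd_coord (i j : Fin 4) :
    cpd i (fun w => (w j : ℂ)) z = if j = i then 1 else 0 := by
  rw [cpd_ofReal i (differentiableAt_apply j z)]
  have : fderiv ℝ (fun w : Fin 4 → ℝ => w j) z = ContinuousLinearMap.proj j :=
    (ContinuousLinearMap.proj (R := ℝ) (φ := fun _ : Fin 4 => ℝ) j).hasFDerivAt.fderiv
  rw [pd, this]
  by_cases hij : j = i
  · subst hij; simp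
  · simp [hij]

theorem contDiffOn_cpd (hM : IsOpen M) (hf : ContDiffOn ℝ ∞ f M) (i : Fin 4) :
    ContDiffOn ℝ ∞ (cpd i f) M :=
  (hf.fderiv_of_isOpen hM (by simp)).clm_apply contDiffOn_const

theorem cpd_comm (hM : IsOpen M) (hf : ContDiffOn ℝ ∞ f M) (hz : z ∈ M) (i j : Fin 4) :
    cpd i (cpd j f) z = cpd j (cpd i f) z := by
  have hat : ContDiffAt ℝ ∞ f z := hf.contDiffAt (hM.mem_nhds hz)
  have hs : IsSymmSndFDerivAt ℝ f z := hat.isSymmSndFDerivAt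
    (by simp; exact WithTop.coe_le_coe.2 (le_top : (2 : ℕ∞) ≤ ⊤))
  have hd : DifferentiableAt ℝ (fderiv ℝ f) z :=
    (hat.fderiv_right (m := 1) (by norm_cast)).differentiableAt (by norm_num)
  have key : ∀ a b : Fin 4, cpd a (cpd b f) z
      = fderiv ℝ (fderiv ℝ f) z (Pi.single a 1) (Pi.single b 1) := by
    intro a b
    have h := hd.hasFDerivAt.clm_apply (hasFDerivAt_const (Pi.single b (1 : ℝ)) z)
    have h2 : HasFDerivAt (cpd b f) _ z := h
    rw [cpd, h2.fderiv]
    simp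
  rw [key, key, hs.eq]

theorem _root_.ContDiffOn.differentiableAt_of_isOpen (hf : ContDiffOn ℝ ∞ f M) (hM : IsOpen M)
    (hz : z ∈ M) : DifferentiableAt ℝ f z :=
  (hf.contDiffAt (hM.mem_nhds hz)).differentiableAt (by simp)

theorem contDiff_coord (j : Fin 4) : ContDiff ℝ ∞ (fun w : Fin 4 → ℝ => (w j : ℂ)) :=
  Complex.ofRealCLM.contDiff.comp (contDiff_apply ℝ ℝ j)

end Calculus

/-! ### Polynomials in `r` with `r`-independent coefficients -/

/-- Smooth functions on `M` that do not depend on the coordinate `r`. Independence is required at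
all points, so that it passes to derivatives whatever the shape of `M`. -/
def RIndep (M : Set (Fin 4 → ℝ)) (f : (Fin 4 → ℝ) → ℂ) : Prop :=
  ContDiffOn ℝ ∞ f M ∧ ∀ z t, f (Function.update z 1 t) = f z

/-- `RPoly M d f`: on `M`, the function `f` is a polynomial in `r` of degree less than `d` whose
coefficients are smooth and independent of `r`. -/
inductive RPoly (M : Set (Fin 4 → ℝ)) (d : ℕ) : ((Fin 4 → ℝ) → ℂ) → Prop
  | zero : RPoly M d (fun _ => 0)
  | monomial {j : ℕ} (hj : j < d) {f : (Fin 4 → ℝ) → ℂ} (hf : RIndep M f) :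
      RPoly M d (fun z => (z 1 : ℂ) ^ j * f z)
  | add {f g : (Fin 4 → ℝ) → ℂ} : RPoly M d f → RPoly M d g → RPoly M d (fun z => f z + g z)
  | congr {f g : (Fin 4 → ℝ) → ℂ} : RPoly M d f → (∀ z ∈ M, f z = g z) → RPoly M d g

section RIndep

variable {M : Set (Fin 4 → ℝ)} {f g : (Fin 4 → ℝ) → ℂ}

theorem RIndep.const (c : ℂ) : RIndep M (fun _ => c) := ⟨contDiffOn_const, fun _ _ => rfl⟩

theorem RIndep.coord {j : Fin 4} (hj : j ≠ 1) : RIndep M (fun z => (z j : ℂ)) :=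
  ⟨(contDiff_coord j).contDiffOn, fun z t => by simp [Function.update_of_ne hj]⟩

theorem RIndep.add (hf : RIndep M f) (hg : RIndep M g) : RIndep M (fun z => f z + g z) :=
  ⟨hf.1.add hg.1, fun z t => by simp only [hf.2, hg.2]⟩

theorem RIndep.mul (hf : RIndep M f) (hg : RIndep M g) : RIndep M (fun z => f z * g z) :=
  ⟨hf.1.mul hg.1, fun z t => by simp only [hf.2, hg.2]⟩

theorem RIndep.sub (hf : RIndep M f) (hg : RIndep M g) : RIndep M (fun z => f z - g z) :=
  ⟨hf.1.sub hg.1, fun z t => by simp only [hf.2, hg.2]⟩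

theorem RIndep.cpd (hM : IsOpen M) (hf : RIndep M f) (i : Fin 4) : RIndep M (cpd i f) := by
  refine ⟨contDiffOn_cpd hM hf.1 i, fun z t => ?_⟩
  have hshift : (fun w => f (w + Pi.single 1 (t - z 1))) = f := by
    funext w
    rw [← hf.2 w (w 1 + (t - z 1))]
    congr 1
    ext j
    by_cases hj : j = 1
    · subst hj; simp
    · simp [Function.update_of_ne hj, Pi.single_eq_of_ne hj]
  have hz : Function.update z 1 t = z + Pi.single 1 (t - z 1) := by
    ext j
    by_cases hj : j = 1
    · subst hj; simp
    · simp [Function.update_of_ne hj, Pi.single_eq_of_ne hj]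
  rw [EMField.cpd, EMField.cpd, hz, ← fderiv_comp_add_right, hshift]

theorem RIndep.cpd_one (hf : RIndep M f) (z : Fin 4 → ℝ) : EMField.cpd 1 f z = 0 := by
  by_cases hd : DifferentiableAt ℝ f z
  · have hline : HasDerivAt (fun t : ℝ => z + t • (Pi.single 1 1 : Fin 4 → ℝ))
        (Pi.single 1 1) 0 := by
      simpa using ((hasDerivAt_id (0 : ℝ)).smul_const (Pi.single 1 1 : Fin 4 → ℝ)).const_add z
    have hd' : HasFDerivAt f (fderiv ℝ f z) (z + (0 : ℝ) • (Pi.single 1 1 : Fin 4 → ℝ)) := by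
      simpa using hd.hasFDerivAt
    have h := hd'.comp_hasDerivAt (0 : ℝ) hline
    have hconst : (f ∘ fun t : ℝ => z + t • (Pi.single 1 1 : Fin 4 → ℝ)) = fun _ => f z := by
      funext t
      rw [Function.comp, ← hf.2 z (z 1 + t)]
      congr 1
      ext j
      by_cases hj : j = 1
      · subst hj; simp
      · simp [Function.update_of_ne hj, Pi.single_eq_of_ne hj]
    rw [hconst] at h
    exact h.unique (hasDerivAt_const _ _)
  · simp [EMField.cpd, fderiv_zero_of_not_differentiableAt hd]

end RIndep

namespace RPoly

variable {M : Set (Fin 4 → ℝ)} {d : ℕ} {f g : (Fin 4 → ℝ) → ℂ}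

theorem of_rIndep (hd : 0 < d) (hf : RIndep M f) : RPoly M d f :=
  (monomial hd hf).congr fun z _ => by simp

theorem mono {d' : ℕ} (hd : d ≤ d') (hf : RPoly M d f) : RPoly M d' f := by
  induction hf with
  | zero => exact zero
  | monomial hj hf => exact monomial (hj.trans_le hd) hf
  | add _ _ hf hg => exact hf.add hg
  | congr _ h hf => exact hf.congr h

theorem contDiffOn (hf : RPoly M d f) : ContDiffOn ℝ ∞ f M := by
  induction hf with
  | zero => exact contDiffOn_const
  | monomial _ hf => exact ((contDiff_coord 1).contDiffOn.pow _).mul hf.1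
  | add _ _ hf hg => exact hf.add hg
  | congr _ h hf => exact hf.congr fun z hz => (h z hz).symm

theorem mul_rIndep (hg : RIndep M g) (hf : RPoly M d f) : RPoly M d (fun z => g z * f z) := by
  induction hf with
  | zero => exact zero.congr fun z _ => by simp
  | monomial hj hf => exact (monomial hj (hg.mul hf)).congr fun z _ => by ring
  | add _ _ hf hg => exact (hf.add hg).congr fun z _ => by ring
  | congr _ h hf => exact hf.congr fun z hz => by rw [h z hz]

theorem const_mul (c : ℂ) (hf : RPoly M d f) : RPoly M d (fun z => c * f z) :=
  mul_rIndep (RIndep.const c) hf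

theorem r_mul (hf : RPoly M d f) : RPoly M (d + 1) (fun z => (z 1 : ℂ) * f z) := by
  induction hf with
  | zero => exact zero.congr fun z _ => by simp
  | @monomial j hj f hf =>
    exact (monomial (j := j + 1) (by omega) hf).congr fun z _ => by ring
  | add _ _ hf hg => exact (hf.add hg).congr fun z _ => by ring
  | congr _ h hf => exact hf.congr fun z hz => by rw [h z hz]

theorem mul {d' : ℕ} (hf : RPoly M (d + 1) f) (hg : RPoly M (d' + 1) g) :
    RPoly M (d + d' + 1) (fun z => f z * g z) := by
  induction hf with
  | zero => exact zero.congr fun z _ => by simp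
  | @monomial j hj f hf =>
    induction hg with
    | zero => exact zero.congr fun z _ => by simp
    | @monomial j' hj' g hg =>
      exact (monomial (j := j + j') (by omega) (hf.mul hg)).congr fun z _ => by ring
    | add _ _ hf hg => exact (hf.add hg).congr fun z _ => by ring
    | congr _ h hf => exact hf.congr fun z hz => by rw [h z hz]
  | add _ _ hf hg => exact (hf.add hg).congr fun z _ => by ring
  | congr _ h hf => exact hf.congr fun z hz => by rw [h z hz]

theorem eq_zero (hf : RPoly M 0 f) : ∀ z ∈ M, f z = 0 := by
  induction hf with
  | zero => simp
  | monomial hj _ => omega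
  | add _ _ hf hg => intro z hz; simp [hf z hz, hg z hz]
  | congr _ h hf => intro z hz; rw [← h z hz, hf z hz]

theorem cpd_rpow (j : ℕ) (i : Fin 4) (z : Fin 4 → ℝ) :
    EMField.cpd i (fun w => (w 1 : ℂ) ^ j) z
      = if i = 1 then (j : ℂ) * (z 1 : ℂ) ^ (j - 1) else 0 := by
  have h1 : DifferentiableAt ℝ (fun w : Fin 4 → ℝ => (w 1 : ℂ)) z :=
    (contDiff_coord 1).differentiable (by simp) z
  have h := cpd_coord (z := z) i 1
  simp only [EMField.cpd] at h ⊢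
  rw [fderiv_fun_pow _ h1]
  by_cases hi : i = 1
  · subst hi; simp at h ⊢; rw [h]; simp
  · simp [hi, Ne.symm hi] at h ⊢; right; exact h

theorem differentiableAt_rpow (j : ℕ) (z : Fin 4 → ℝ) :
    DifferentiableAt ℝ (fun w : Fin 4 → ℝ => (w 1 : ℂ) ^ j) z :=
  ((contDiff_coord 1).differentiable (by simp) z).pow j

theorem cpd (hM : IsOpen M) {i : Fin 4} (hi : i ≠ 1) (hf : RPoly M d f) :
    RPoly M d (EMField.cpd i f) := by
  induction hf with
  | zero => exact zero.congr fun z _ => by simp [cpd_const]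
  | @monomial j hj f hf =>
    refine (monomial hj (hf.cpd hM i)).congr fun z hz => ?_
    rw [cpd_mul i (differentiableAt_rpow j z) (hf.1.differentiableAt_of_isOpen hM hz), cpd_rpow]
    simp [hi]
  | add hf' hg' hf hg =>
    exact (hf.add hg).congr fun z hz => (cpd_add i (hf'.contDiffOn.differentiableAt_of_isOpen hM hz)
      (hg'.contDiffOn.differentiableAt_of_isOpen hM hz)).symm
  | congr _ h hf => exact hf.congr fun z hz => cpd_congr hM hz h i

theorem cpd_one (hM : IsOpen M) (hf : RPoly M (d + 1) f) : RPoly M d (EMField.cpd 1 f) := by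
  induction hf with
  | zero => exact zero.congr fun z _ => by simp [cpd_const]
  | @monomial j hj f hf =>
    have key : ∀ z ∈ M, EMField.cpd 1 (fun w => (w 1 : ℂ) ^ j * f w) z
        = (z 1 : ℂ) ^ (j - 1) * ((j : ℂ) * f z) := fun z hz => by
      rw [cpd_mul 1 (differentiableAt_rpow j z) (hf.1.differentiableAt_of_isOpen hM hz), cpd_rpow,
        hf.cpd_one]
      simp; ring
    rcases Nat.eq_zero_or_pos j with rfl | hj0
    · exact zero.congr fun z hz => by rw [key z hz]; simp
    · exact (monomial (j := j - 1) (by omega) ((RIndep.const (j : ℂ)).mul hf)).congr fun z hz =>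
        (key z hz).symm
  | add hf' hg' hf hg =>
    exact (hf.add hg).congr fun z hz => (cpd_add 1 (hf'.contDiffOn.differentiableAt_of_isOpen hM hz)
      (hg'.contDiffOn.differentiableAt_of_isOpen hM hz)).symm
  | congr _ h hf => exact hf.congr fun z hz => cpd_congr hM hz h 1

end RPoly

/-! ### Spin-weighted derivatives -/

/-- The transverse null derivatives `P (∂_x - ε i ∂_y)`, where `ε = ±1`. -/
def nullD (k : ℝ) (ε : ℂ) (f : (Fin 4 → ℝ) → ℂ) (z : Fin 4 → ℝ) : ℂ :=
  (kundtP k (z 2) (z 3) : ℂ) * (cpd 2 f z - ε * Complex.I * cpd 3 f z)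

/-- The function `(∂_x - ε i ∂_y) P`, the transverse connection coefficient in the null frame. -/
def spinConn (k : ℝ) (ε : ℂ) (z : Fin 4 → ℝ) : ℂ :=
  -2 * k * (z 2 - ε * Complex.I * z 3)

/-- The spin-raising (`ε = 1`) and spin-lowering (`ε = -1`) operator of the transverse metric on
functions of spin weight `s`. -/
def eth (k : ℝ) (ε : ℂ) (s : ℤ) (f : (Fin 4 → ℝ) → ℂ) (z : Fin 4 → ℝ) : ℂ :=
  nullD k ε f z + ε * s * spinConn k ε z * f z

section Eth

variable {M : Set (Fin 4 → ℝ)} {k : ℝ} {ε : ℂ} {s : ℤ} {f g : (Fin 4 → ℝ) → ℂ} {z : Fin 4 → ℝ}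

theorem rIndep_kundtP : RIndep M (fun z => (kundtP k (z 2) (z 3) : ℂ)) := by
  have hx : RIndep M (fun z => (z 2 : ℂ)) := RIndep.coord (by decide)
  have hy : RIndep M (fun z => (z 3 : ℂ)) := RIndep.coord (by decide)
  have h := (RIndep.const (M := M) 1).sub
    ((RIndep.const (k : ℂ)).mul ((hx.mul hx).add (hy.mul hy)))
  convert h using 2
  simp [kundtP, sq]

theorem rIndep_spinConn : RIndep M (spinConn k ε) := by
  have hx : RIndep M (fun z => (z 2 : ℂ)) := RIndep.coord (by decide)
  have hy : RIndep M (fun z => (z 3 : ℂ)) := RIndep.coord (by decide)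
  exact (RIndep.const (M := M) (-2 * k : ℂ)).mul (hx.sub ((RIndep.const (ε * Complex.I)).mul hy))

theorem RIndep.nullD (hM : IsOpen M) (hf : RIndep M f) : RIndep M (nullD k ε f) :=
  rIndep_kundtP.mul ((hf.cpd hM 2).sub ((RIndep.const (ε * Complex.I)).mul (hf.cpd hM 3)))

theorem RIndep.eth (hM : IsOpen M) (hf : RIndep M f) : RIndep M (eth k ε s f) :=
  (hf.nullD hM).add (((RIndep.const (ε * s)).mul rIndep_spinConn).mul hf)

theorem RPoly.eth {d : ℕ} (hM : IsOpen M) (hf : RPoly M d f) : RPoly M d (eth k ε s f) := by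
  have h2 := (hf.cpd hM (i := 2) (by decide))
  have h3 := (hf.cpd hM (i := 3) (by decide)).const_mul (-(ε * Complex.I))
  have h4 := (RPoly.mul_rIndep (rIndep_spinConn (k := k) (ε := ε)) hf).const_mul (ε * s)
  exact ((RPoly.mul_rIndep (rIndep_kundtP (k := k)) (h2.add h3)).add h4).congr fun z _ => by
    simp only [EMField.eth, EMField.nullD]; ring

theorem eth_congr (hM : IsOpen M) (hz : z ∈ M) (h : ∀ w ∈ M, f w = g w) :
    eth k ε s f z = eth k ε s g z := by
  simp only [eth, nullD, cpd_congr hM hz h, h z hz]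

theorem nullD_const (c : ℂ) : nullD k ε (fun _ => c) z = 0 := by
  simp [nullD, cpd_const]

theorem nullD_add (hf : DifferentiableAt ℝ f z) (hg : DifferentiableAt ℝ g z) :
    nullD k ε (fun w => f w + g w) z = nullD k ε f z + nullD k ε g z := by
  simp only [nullD, cpd_add _ hf hg]; ring

theorem nullD_mul (hf : DifferentiableAt ℝ f z) (hg : DifferentiableAt ℝ g z) :
    nullD k ε (fun w => f w * g w) z = nullD k ε f z * g z + f z * nullD k ε g z := by
  simp only [nullD, cpd_mul _ hf hg]; ring

theorem nullD_rpow (j : ℕ) : nullD k ε (fun w => (w 1 : ℂ) ^ j) z = 0 := by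
  simp [nullD, RPoly.cpd_rpow]

theorem eth_const_mul (c : ℂ) (hf : DifferentiableAt ℝ f z) :
    eth k ε s (fun w => c * f w) z = c * eth k ε s f z := by
  simp only [eth, nullD_mul (differentiableAt_const c) hf, nullD_const]; ring

end Eth

/-! ### Admissible frame components -/

/-- The functions that occur as frame components of constructed tensors. Such a component has a
level `b` (minus its boost weight) and a spin weight `s`. It vanishes on `M` if `b < 0`; it is a
constant, zero unless `s = 0`, if `b = 0`; and if `b = m + 1` it is a polynomial in `r` of degree at
most `m` whose coefficient of `r ^ m` is a constant multiple of the function `Φ s`. -/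
def Adm (M : Set (Fin 4 → ℝ)) (Φ : ℤ → (Fin 4 → ℝ) → ℂ) (b s : ℤ) (f : (Fin 4 → ℝ) → ℂ) : Prop :=
  (b < 0 → ∀ z ∈ M, f z = 0) ∧
  (b = 0 → ∃ c : ℂ, (s ≠ 0 → c = 0) ∧ ∀ z ∈ M, f z = c) ∧
  ∀ m : ℕ, b = m + 1 → ∃ (c : ℂ) (q : (Fin 4 → ℝ) → ℂ), RPoly M m q ∧
    ∀ z ∈ M, f z = c * ((z 1 : ℂ) ^ m * Φ s z) + q z

namespace Adm

variable {M : Set (Fin 4 → ℝ)} {Φ : ℤ → (Fin 4 → ℝ) → ℂ} {b s b' s' : ℤ}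
  {f g : (Fin 4 → ℝ) → ℂ}

theorem congr (hf : Adm M Φ b s f) (h : ∀ z ∈ M, g z = f z) : Adm M Φ b s g := by
  refine ⟨fun hb z hz => by rw [h z hz, hf.1 hb z hz], fun hb => ?_, fun m hm => ?_⟩
  · obtain ⟨c, hc, hfc⟩ := hf.2.1 hb
    exact ⟨c, hc, fun z hz => by rw [h z hz, hfc z hz]⟩
  · obtain ⟨c, q, hq, hfc⟩ := hf.2.2 m hm
    exact ⟨c, q, hq, fun z hz => by rw [h z hz, hfc z hz]⟩

theorem zero : Adm M Φ b s (fun _ => 0) :=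
  ⟨fun _ _ _ => rfl, fun _ => ⟨0, fun _ => rfl, fun _ _ => rfl⟩,
    fun _ _ => ⟨0, _, RPoly.zero, fun _ _ => by simp⟩⟩

theorem of_eq_zero (h : ∀ z ∈ M, f z = 0) : Adm M Φ b s f := zero.congr h

theorem const {c : ℂ} (hs : s ≠ 0 → c = 0) : Adm M Φ 0 s (fun _ => c) :=
  ⟨fun h => absurd h (lt_irrefl _), fun _ => ⟨c, hs, fun _ _ => rfl⟩, fun m hm => by omega⟩

theorem of_succ (m : ℕ) (c : ℂ) {q : (Fin 4 → ℝ) → ℂ} (hq : RPoly M m q)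
    (h : ∀ z ∈ M, f z = c * ((z 1 : ℂ) ^ m * Φ s z) + q z) : Adm M Φ (m + 1) s f := by
  refine ⟨fun h => by omega, fun h => by omega, fun m' hm' => ?_⟩
  obtain rfl : m = m' := by omega
  exact ⟨c, q, hq, h⟩

theorem of_rPoly (m : ℕ) (hf : RPoly M m f) : Adm M Φ (m + 1) s f :=
  of_succ m 0 hf fun z _ => by simp

theorem add (hf : Adm M Φ b s f) (hg : Adm M Φ b s g) : Adm M Φ b s (fun z => f z + g z) := by
  refine ⟨fun hb z hz => by dsimp only; rw [hf.1 hb z hz, hg.1 hb z hz, add_zero], fun hb => ?_,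
    fun m hm => ?_⟩
  · obtain ⟨c, hc, hfc⟩ := hf.2.1 hb
    obtain ⟨c', hc', hgc⟩ := hg.2.1 hb
    exact ⟨c + c', fun h => by rw [hc h, hc' h, add_zero], fun z hz => by
      dsimp only; rw [hfc z hz, hgc z hz]⟩
  · obtain ⟨c, q, hq, hfc⟩ := hf.2.2 m hm
    obtain ⟨c', q', hq', hgc⟩ := hg.2.2 m hm
    exact ⟨c + c', _, hq.add hq', fun z hz => by dsimp only; rw [hfc z hz, hgc z hz]; ring⟩

theorem const_mul (c : ℂ) (hf : Adm M Φ b s f) : Adm M Φ b s (fun z => c * f z) := by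
  refine ⟨fun hb z hz => by dsimp only; rw [hf.1 hb z hz, mul_zero], fun hb => ?_, fun m hm => ?_⟩
  · obtain ⟨c', hc', hfc⟩ := hf.2.1 hb
    exact ⟨c * c', fun h => by rw [hc' h, mul_zero], fun z hz => by dsimp only; rw [hfc z hz]⟩
  · obtain ⟨c', q, hq, hfc⟩ := hf.2.2 m hm
    exact ⟨c * c', _, hq.const_mul c, fun z hz => by dsimp only; rw [hfc z hz]; ring⟩

theorem sub (hf : Adm M Φ b s f) (hg : Adm M Φ b s g) : Adm M Φ b s (fun z => f z - g z) :=
  (hf.add (hg.const_mul (-1))).congr fun z _ => by ring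

theorem sum {ι : Type*} (t : Finset ι) {F : ι → (Fin 4 → ℝ) → ℂ}
    (hF : ∀ i ∈ t, Adm M Φ b s (F i)) : Adm M Φ b s (fun z => ∑ i ∈ t, F i z) := by
  classical
  induction t using Finset.induction_on with
  | empty => exact of_eq_zero fun z _ => by simp
  | insert a t ha ih =>
    exact ((hF a (Finset.mem_insert_self a t)).add
      (ih fun i hi => hF i (Finset.mem_insert_of_mem hi))).congr
      fun z _ => by rw [Finset.sum_insert ha]

theorem trichotomy (b : ℤ) : b < 0 ∨ b = 0 ∨ ∃ m : ℕ, b = m + 1 := by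
  rcases lt_trichotomy b 0 with h | h | h
  · exact Or.inl h
  · exact Or.inr (Or.inl h)
  · exact Or.inr (Or.inr ⟨(b - 1).toNat, by omega⟩)

/-- On `M`, an admissible function of positive level `m + 1` is a polynomial in `r` of degree at
most `m`. -/
theorem rPoly (hΦ : ∀ s, RIndep M (Φ s)) {m : ℕ} (hf : Adm M Φ (m + 1) s f) :
    RPoly M (m + 1) f := by
  obtain ⟨c, q, hq, h⟩ := hf.2.2 m rfl
  exact (((RPoly.monomial (Nat.lt_succ_self m) (hΦ s)).const_mul c).add
    (hq.mono (Nat.le_succ m))).congr fun z hz => (h z hz).symm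

theorem contDiffOn (hΦ : ∀ s, RIndep M (Φ s)) (hf : Adm M Φ b s f) : ContDiffOn ℝ ∞ f M := by
  rcases trichotomy b with hb | hb | ⟨m, rfl⟩
  · exact contDiffOn_const.congr (hf.1 hb)
  · obtain ⟨c, -, hc⟩ := hf.2.1 hb
    exact contDiffOn_const.congr hc
  · exact (hf.rPoly hΦ).contDiffOn

theorem mul (hΦ : ∀ s, RIndep M (Φ s)) (hf : Adm M Φ b s f) (hg : Adm M Φ b' s' g) :
    Adm M Φ (b + b') (s + s') (fun z => f z * g z) := by
  rcases trichotomy b with hb | rfl | ⟨m, rfl⟩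
  · exact of_eq_zero fun z hz => by rw [hf.1 hb z hz, zero_mul]
  · obtain ⟨c, hc, hfc⟩ := hf.2.1 rfl
    by_cases hs : s = 0
    · subst hs
      rw [zero_add, zero_add]
      exact (hg.const_mul c).congr fun z hz => by rw [hfc z hz]
    · exact of_eq_zero fun z hz => by rw [hfc z hz, hc hs, zero_mul]
  · rcases trichotomy b' with hb | rfl | ⟨m', rfl⟩
    · exact of_eq_zero fun z hz => by rw [hg.1 hb z hz, mul_zero]
    · obtain ⟨c, hc, hgc⟩ := hg.2.1 rfl
      by_cases hs : s' = 0
      · subst hs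
        rw [add_zero, add_zero]
        exact (hf.const_mul c).congr fun z hz => by rw [hgc z hz, mul_comm]
      · exact of_eq_zero fun z hz => by rw [hgc z hz, hc hs, mul_zero]
    · have h := of_rPoly (Φ := Φ) (s := s + s') _ ((hf.rPoly hΦ).mul (hg.rPoly hΦ))
      convert h using 1
      push_cast; ring

/-- A function of `(u, x, y)` times an admissible function is admissible two levels up, with no
condition on the spin weight. -/
theorem rIndep_mul (hΦ : ∀ s, RIndep M (Φ s)) (hg : RIndep M g) (hf : Adm M Φ b s f) :
    Adm M Φ (b + 2) s' (fun z => g z * f z) := by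
  rcases trichotomy b with hb | rfl | ⟨m, rfl⟩
  · exact of_eq_zero fun z hz => by rw [hf.1 hb z hz, mul_zero]
  · obtain ⟨c, -, hfc⟩ := hf.2.1 rfl
    exact (of_rPoly (s := s') 1 (RPoly.of_rIndep Nat.one_pos (hg.mul (RIndep.const c)))).congr
      fun z hz => by rw [hfc z hz]
  · have h := of_rPoly (Φ := Φ) (s := s') (m + 2)
      ((RPoly.mul_rIndep hg (hf.rPoly hΦ)).mono (by omega))
    convert h using 1
    push_cast; ring

theorem cpd_one (hM : IsOpen M) (hΦ : ∀ s, RIndep M (Φ s)) (hf : Adm M Φ b s f) :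
    Adm M Φ (b - 1) s (cpd 1 f) := by
  rcases trichotomy b with hb | rfl | ⟨m, rfl⟩
  · exact of_eq_zero fun z hz => by rw [cpd_congr hM hz (hf.1 hb), cpd_const]
  · obtain ⟨c, -, hc⟩ := hf.2.1 rfl
    exact of_eq_zero fun z hz => by rw [cpd_congr hM hz hc, cpd_const]
  · obtain ⟨c, q, hq, h⟩ := hf.2.2 m rfl
    rcases m with _ | m
    · refine of_eq_zero fun z hz => ?_
      rw [cpd_congr (g := fun z => c * Φ s z) hM hz fun w hw => by
        rw [h w hw, hq.eq_zero w hw]; simp, ((RIndep.const c).mul (hΦ s)).cpd_one]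
    · have h' : Adm M Φ (m + 1) s (cpd 1 f) := by
        refine of_succ m (c * (m + 1)) (hq.cpd_one hM) fun z hz => ?_
        have hd := (hΦ s).1.differentiableAt_of_isOpen hM hz
        have hr := RPoly.differentiableAt_rpow (m + 1) z
        rw [cpd_congr hM hz h, cpd_add _ ((hr.fun_mul hd).const_mul c)
          (hq.contDiffOn.differentiableAt_of_isOpen hM hz), cpd_const_mul _ _ (hr.fun_mul hd),
          cpd_mul _ hr hd, RPoly.cpd_rpow, (hΦ s).cpd_one]
        simp; ring
      convert h' using 1
      push_cast; ring

/-- Transverse covariant differentiation preserves admissibility: this is where the family `Φ`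
has to be closed under the spin-raising and spin-lowering operators. -/
theorem eth {k : ℝ} {ε : ℂ} {δ : ℤ} (hM : IsOpen M) (hΦ : ∀ s, RIndep M (Φ s))
    (hup : ∀ s, ∃ c : ℂ, ∀ z ∈ M, EMField.eth k ε s (Φ s) z = c * Φ (s + δ) z)
    (hf : Adm M Φ b s f) : Adm M Φ b (s + δ) (EMField.eth k ε s f) := by
  rcases trichotomy b with hb | rfl | ⟨m, rfl⟩
  · exact of_eq_zero fun z hz => by
      rw [eth_congr hM hz (hf.1 hb)]; simp [EMField.eth, nullD_const]
  · obtain ⟨c, hs, hc⟩ := hf.2.1 rfl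
    refine of_eq_zero fun z hz => ?_
    rw [eth_congr hM hz hc]
    simp only [EMField.eth, nullD_const]
    by_cases h : s = 0
    · simp [h]
    · simp [hs h]
  · obtain ⟨c, q, hq, h⟩ := hf.2.2 m rfl
    obtain ⟨c', hc'⟩ := hup s
    refine of_succ m (c * c') (hq.eth hM (k := k) (ε := ε) (s := s)) fun z hz => ?_
    have hd := (hΦ s).1.differentiableAt_of_isOpen hM hz
    have hr := RPoly.differentiableAt_rpow m z
    have hq' := hq.contDiffOn.differentiableAt_of_isOpen hM hz
    have h' := hc' z hz
    rw [eth_congr hM hz h]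
    simp only [EMField.eth] at h' ⊢
    rw [nullD_add ((hr.fun_mul hd).const_mul c) hq',
      nullD_mul (differentiableAt_const c) (hr.fun_mul hd),
      nullD_const, nullD_mul hr hd, nullD_rpow]
    linear_combination (c * (z 1 : ℂ) ^ m) * h'

/-- The covariant derivative along `∂_u - (λ r² + H) ∂_r`, including the boost term of the
connection, raises the level by one. -/
theorem boostD {l : ℝ} {h : (Fin 4 → ℝ) → ℂ} (hM : IsOpen M) (hΦ : ∀ s, RIndep M (Φ s))
    (hh : RIndep M h) (hf : Adm M Φ b s f) :
    Adm M Φ (b + 1) s (fun z => cpd 0 f z - (l * (z 1 : ℂ) ^ 2 + h z) * cpd 1 f z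
      + 2 * l * z 1 * b * f z) := by
  rcases trichotomy b with hb | rfl | ⟨m, rfl⟩
  · exact of_eq_zero fun z hz => by
      rw [cpd_congr hM hz (hf.1 hb), cpd_congr hM hz (hf.1 hb), cpd_const, cpd_const, hf.1 hb z hz]
      ring
  · obtain ⟨c, -, hc⟩ := hf.2.1 rfl
    exact of_eq_zero fun z hz => by
      rw [cpd_congr hM hz hc, cpd_congr hM hz hc, cpd_const, cpd_const]
      simp
  · obtain ⟨c, q, hq, hfc⟩ := hf.2.2 m rfl
    have hfp := hf.rPoly hΦ
    have hf1 := hfp.cpd_one hM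
    -- The lower-order part `q` is again of lower order after applying the operator.
    have hq1 : RPoly M (m + 1) (fun z => (z 1 : ℂ) * ((z 1 : ℂ) * cpd 1 q z)) := by
      rcases m with _ | m
      · refine RPoly.zero.congr fun z hz => ?_
        rw [cpd_congr hM hz hq.eq_zero, cpd_const]; simp
      · exact (hq.cpd_one hM).r_mul.r_mul
    have hlow := ((((hfp.cpd hM (i := 0) (by decide)).add
      (((RPoly.mul_rIndep hh hf1).mono (Nat.le_succ m)).const_mul (-1))).add
      (hq1.const_mul (-l))).add (hq.r_mul.const_mul (2 * l * (m + 1))))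
    have h' := of_succ (Φ := Φ) (s := s) (m + 1) (c * l * (m + 2)) hlow
      (f := fun z => cpd 0 f z - (l * (z 1 : ℂ) ^ 2 + h z) * cpd 1 f z
        + 2 * l * z 1 * ((m + 1 : ℤ) : ℂ) * f z) fun z hz => by
        have hd := (hΦ s).1.differentiableAt_of_isOpen hM hz
        have hr := RPoly.differentiableAt_rpow m z
        have hq' := hq.contDiffOn.differentiableAt_of_isOpen hM hz
        have h1 : cpd 1 f z = c * (m * (z 1 : ℂ) ^ (m - 1) * Φ s z) + cpd 1 q z := by
          rw [cpd_congr hM hz hfc, cpd_add _ ((hr.fun_mul hd).const_mul c) hq',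
            cpd_const_mul _ _ (hr.fun_mul hd), cpd_mul _ hr hd, RPoly.cpd_rpow, (hΦ s).cpd_one]
          simp
        have hpow : (m : ℂ) * (z 1 : ℂ) ^ (m - 1) * (z 1 : ℂ) ^ 2 = m * (z 1 : ℂ) ^ (m + 1) := by
          rcases m with _ | m
          · simp
          · simp only [Nat.add_sub_cancel]; ring
        have hfz := hfc z hz
        push_cast
        linear_combination (2 * l * z 1 * (m + 1)) * hfz - (l * (z 1 : ℂ) ^ 2) * h1
          - (l * c * Φ s z) * hpow
    convert h' using 1
    push_cast; ring

end Adm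

/-! ### The spin-weighted derivatives of a harmonic function -/

section Potential

variable {M : Set (Fin 4 → ℝ)} {k : ℝ} {f : (Fin 4 → ℝ) → ℂ} {z : Fin 4 → ℝ}

theorem cpd_kundtP (i : Fin 4) :
    cpd i (fun z => (kundtP k (z 2) (z 3) : ℂ)) z
      = -2 * k * ((if 2 = i then 1 else 0) * z 2 + (if 3 = i then 1 else 0) * z 3) := by
  have h2 : DifferentiableAt ℝ (fun w : Fin 4 → ℝ => (w 2 : ℂ)) z :=
    (contDiff_coord 2).differentiable (by simp) z
  have h3 : DifferentiableAt ℝ (fun w : Fin 4 → ℝ => (w 3 : ℂ)) z :=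
    (contDiff_coord 3).differentiable (by simp) z
  have e : (fun z : Fin 4 → ℝ => (kundtP k (z 2) (z 3) : ℂ))
      = fun z => 1 - (k : ℂ) * ((z 2 : ℂ) * z 2 + (z 3 : ℂ) * z 3) := by
    funext w; simp [kundtP, sq]
  rw [e, cpd_sub _ (differentiableAt_const _)
    (((h2.fun_mul h2).fun_add (h3.fun_mul h3)).const_mul _), cpd_const,
    cpd_const_mul _ _ ((h2.fun_mul h2).fun_add (h3.fun_mul h3)),
    cpd_add _ (h2.fun_mul h2) (h3.fun_mul h3), cpd_mul _ h2 h2, cpd_mul _ h3 h3, cpd_coord,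
    cpd_coord]
  ring

theorem cpd_spinConn (ε : ℂ) (i : Fin 4) :
    cpd i (spinConn k ε) z
      = -2 * k * ((if 2 = i then 1 else 0) - ε * Complex.I * (if 3 = i then 1 else 0)) := by
  have h2 : DifferentiableAt ℝ (fun w : Fin 4 → ℝ => (w 2 : ℂ)) z :=
    (contDiff_coord 2).differentiable (by simp) z
  have h3 : DifferentiableAt ℝ (fun w : Fin 4 → ℝ => (w 3 : ℂ)) z :=
    (contDiff_coord 3).differentiable (by simp) z
  have e : spinConn k ε = fun z => (-2 * k : ℂ) * ((z 2 : ℂ) - (ε * Complex.I) * (z 3 : ℂ)) := rfl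
  rw [e, cpd_const_mul _ _ (h2.fun_sub (h3.const_mul _)), cpd_sub _ h2 (h3.const_mul _),
    cpd_const_mul _ _ h3, cpd_coord, cpd_coord]

theorem cpd_eth (hM : IsOpen M) (hf : ContDiffOn ℝ ∞ f M) (hz : z ∈ M) (ε : ℂ) (s : ℤ)
    (i : Fin 4) :
    cpd i (eth k ε s f) z
      = cpd i (fun z => (kundtP k (z 2) (z 3) : ℂ)) z * (cpd 2 f z - ε * Complex.I * cpd 3 f z)
        + (kundtP k (z 2) (z 3) : ℂ) * (cpd i (cpd 2 f) z - ε * Complex.I * cpd i (cpd 3 f) z)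
        + ε * s * (cpd i (spinConn k ε) z * f z + spinConn k ε z * cpd i f z) := by
  have d2 := (contDiffOn_cpd hM hf 2).differentiableAt_of_isOpen hM hz
  have d3 := (contDiffOn_cpd hM hf 3).differentiableAt_of_isOpen hM hz
  have df := hf.differentiableAt_of_isOpen hM hz
  have dP := (rIndep_kundtP (M := M) (k := k)).1.differentiableAt_of_isOpen hM hz
  have dp := (rIndep_spinConn (M := M) (k := k) (ε := ε)).1.differentiableAt_of_isOpen hM hz
  have e : eth k ε s f = fun z => (kundtP k (z 2) (z 3) : ℂ) *
      (cpd 2 f z - (ε * Complex.I) * cpd 3 f z) + (ε * s * spinConn k ε z) * f z := rfl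
  rw [e, cpd_add _ (dP.fun_mul (d2.fun_sub (d3.const_mul _))) ((dp.const_mul _).fun_mul df),
    cpd_mul _ dP (d2.fun_sub (d3.const_mul _)), cpd_sub _ d2 (d3.const_mul _),
    cpd_const_mul _ _ d3, cpd_mul _ (dp.const_mul _) df, cpd_const_mul _ _ dp]
  ring

/-- The commutator of the spin-raising and spin-lowering operators is a constant multiple of the
spin weight, because the transverse metric has constant curvature. -/
theorem eth_comm (hM : IsOpen M) (hf : ContDiffOn ℝ ∞ f M) (hz : z ∈ M) {δ : ℤ} (hδ : δ * δ = 1)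
    (s : ℤ) :
    eth k (-δ) (s + δ) (eth k δ s f) z
      = eth k δ (s - δ) (eth k (-δ) s f) z - 8 * k * (δ * s) * f z := by
  have hc := cpd_comm hM hf hz 2 3
  have hP : (kundtP k (z 2) (z 3) : ℂ) = 1 - k * ((z 2 : ℂ) ^ 2 + (z 3 : ℂ) ^ 2) := by
    simp [kundtP]
  rcases Int.isUnit_iff.1 (IsUnit.of_mul_eq_one δ hδ) with rfl | rfl
  all_goals
    rw [eth, nullD, cpd_eth hM hf hz, cpd_eth hM hf hz]
    conv_rhs => rw [eth, nullD, cpd_eth hM hf hz, cpd_eth hM hf hz]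
    simp only [eth, nullD, cpd_kundtP, cpd_spinConn, spinConn, hc]
    simp
    rw [hP]
    ring_nf
    simp only [Complex.I_sq]
    ring

/-- The repeated spin-weighted derivatives of `f`: `potential k f δ n` has spin weight `δ n`, where
`δ = 1` or `δ = -1`. For `n = 0` it is set to zero: the contractions of the derivatives of a
harmonic function that have spin weight zero all vanish. -/
def potential (k : ℝ) (f : (Fin 4 → ℝ) → ℂ) (δ : ℤ) : ℕ → (Fin 4 → ℝ) → ℂ
  | 0 => fun _ => 0
  | 1 => nullD k δ f
  | n + 2 => eth k δ (δ * (n + 1)) (potential k f δ (n + 1))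

theorem rIndep_potential (hM : IsOpen M) (hf : RIndep M f) (δ : ℤ) :
    ∀ n, RIndep M (potential k f δ n)
  | 0 => RIndep.const 0
  | 1 => hf.nullD hM
  | n + 2 => (rIndep_potential hM hf δ (n + 1)).eth hM

theorem eth_zero (ε : ℂ) (s : ℤ) : eth k ε s (fun _ => 0) z = 0 := by
  simp [eth, nullD_const]

theorem eth_potential_up (δ : ℤ) (n : ℕ) :
    ∃ c : ℂ, ∀ z, eth k δ (δ * n) (potential k f δ n) z = c * potential k f δ (n + 1) z := by
  rcases n with _ | n
  · exact ⟨0, fun z => by simp [potential, eth_zero]⟩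
  · exact ⟨1, fun z => by simp [potential]⟩

/-- Lowering a spin-weighted derivative of a harmonic function gives back the previous one up to
a constant. -/
theorem eth_potential_down (hM : IsOpen M) (hf : RIndep M f)
    (hharm : ∀ z ∈ M, cpd 2 (cpd 2 f) z + cpd 3 (cpd 3 f) z = 0) {δ : ℤ} (hδ : δ * δ = 1) (n : ℕ) :
    ∃ c : ℂ, ∀ z ∈ M, eth k (-δ) (δ * (n + 1 : ℕ)) (potential k f δ (n + 1)) z
      = c * potential k f δ n z := by
  induction n with
  | zero =>
    refine ⟨0, fun z hz => ?_⟩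
    have h1 : ∀ w, nullD k δ f w = eth k δ 0 f w := fun w => by simp [eth]
    have hc := cpd_comm hM hf.1 hz 2 3
    have hh := hharm z hz
    have e : potential k f δ (0 + 1) = eth k δ 0 f := funext h1
    rw [e, eth, nullD, cpd_eth hM hf.1 hz, cpd_eth hM hf.1 hz]
    have hcc : cpd 3 (cpd 3 f) z = - cpd 2 (cpd 2 f) z := by linear_combination hh
    rcases Int.isUnit_iff.1 (IsUnit.of_mul_eq_one δ hδ) with rfl | rfl
    all_goals
      simp only [eth, nullD, cpd_kundtP, spinConn, hc, hcc]
      simp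
      ring_nf
      simp only [Complex.I_sq]
      ring
  | succ n ih =>
    obtain ⟨c, hc⟩ := ih
    obtain ⟨c', hc'⟩ := eth_potential_up (k := k) (f := f) δ n
    refine ⟨c * c' - 8 * k * (n + 1), fun z hz => ?_⟩
    have hs := (rIndep_potential (k := k) hM hf δ (n + 1)).1
    have hcomm := eth_comm (k := k) hM hs hz hδ (δ * (n + 1))
    have hd : (δ : ℂ) * δ = 1 := by exact_mod_cast hδ
    have e1 : δ * ((n + 1 + 1 : ℕ) : ℤ) = δ * (n + 1) + δ := by push_cast; ring
    have e2 : δ * ((n : ℤ) + 1) - δ = δ * n := by ring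
    have e3 : ∀ w ∈ M, eth k (-δ) (δ * ((n : ℤ) + 1)) (potential k f δ (n + 1)) w
        = c * potential k f δ n w := fun w hw => by
      have := hc w hw
      push_cast at this
      exact this
    rw [e1]
    change eth k (-δ) (δ * (n + 1) + δ)
      (eth k δ (δ * (n + 1)) (potential k f δ (n + 1))) z = _
    rw [hcomm, e2, eth_congr hM hz e3, eth_const_mul _
      ((rIndep_potential (k := k) hM hf δ n).1.differentiableAt_of_isOpen hM hz), hc' z]
    push_cast
    linear_combination (-8 * k * (n + 1) * potential k f δ (n + 1) z) * hd

/-- The spin-weighted derivatives of `f` of all spin weights. -/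
def potentials (k : ℝ) (f : (Fin 4 → ℝ) → ℂ) (s : ℤ) : (Fin 4 → ℝ) → ℂ :=
  potential k f s.sign s.natAbs

theorem rIndep_potentials (hM : IsOpen M) (hf : RIndep M f) (s : ℤ) :
    RIndep M (potentials k f s) := rIndep_potential hM hf _ _

theorem potentials_mul_natCast {δ : ℤ} (hδ : δ * δ = 1) (n : ℕ) :
    potentials k f (δ * n) = potential k f δ n := by
  rcases Int.isUnit_iff.1 (IsUnit.of_mul_eq_one δ hδ) with rfl | rfl <;> rcases n with _ | n
  · simp [potentials, potential]
  · have : Int.sign (1 * ((n + 1 : ℕ) : ℤ)) = 1 := by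
      rw [one_mul]; exact Int.sign_eq_one_of_pos (by positivity)
    rw [potentials, this, one_mul, Int.natAbs_natCast]
  · simp [potentials, potential]
  · have : Int.sign (-1 * ((n + 1 : ℕ) : ℤ)) = -1 := by
      apply Int.sign_eq_neg_one_of_neg; push_cast; linarith
    rw [potentials, this, neg_one_mul, Int.natAbs_neg, Int.natAbs_natCast]

/-- The spin-weighted derivatives of a harmonic function are closed, up to constant factors, under
the operators that raise and lower the spin weight. -/
theorem eth_potentials (hM : IsOpen M) (hf : RIndep M f)
    (hharm : ∀ z ∈ M, cpd 2 (cpd 2 f) z + cpd 3 (cpd 3 f) z = 0) {δ : ℤ} (hδ : δ * δ = 1) (s : ℤ) :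
    ∃ c : ℂ, ∀ z ∈ M, eth k δ s (potentials k f s) z = c * potentials k f (s + δ) z := by
  have hδ' : (-δ) * (-δ) = 1 := by rw [neg_mul_neg, hδ]
  obtain ⟨n, rfl | rfl⟩ : ∃ n : ℕ, s = δ * n ∨ s = -δ * (n + 1 : ℕ) := by
    rcases Int.isUnit_iff.1 (IsUnit.of_mul_eq_one δ hδ) with rfl | rfl
    · rcases le_or_gt 0 s with h | h
      · exact ⟨s.toNat, Or.inl (by omega)⟩
      · exact ⟨(-s - 1).toNat, Or.inr (by omega)⟩
    · rcases lt_or_ge 0 s with h | h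
      · exact ⟨(s - 1).toNat, Or.inr (by omega)⟩
      · exact ⟨(-s).toNat, Or.inl (by omega)⟩
  · obtain ⟨c, hc⟩ := eth_potential_up (k := k) (f := f) δ n
    refine ⟨c, fun z _ => ?_⟩
    have e : δ * (n : ℤ) + δ = δ * (n + 1 : ℕ) := by push_cast; ring
    rw [e, potentials_mul_natCast hδ, potentials_mul_natCast hδ, hc z]
  · obtain ⟨c, hc⟩ := eth_potential_down (k := k) hM hf hharm hδ' n
    refine ⟨c, fun z hz => ?_⟩
    have e : -δ * ((n + 1 : ℕ) : ℤ) + δ = -δ * n := by push_cast; ring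
    rw [e, potentials_mul_natCast hδ', potentials_mul_natCast hδ', ← hc z hz]
    simp

end Potential

/-! ### Frame components of tensor fields -/

/-- The component `T(e_{I 0}, …, e_{I (m-1)})` of a tensor field in the complex frame whose `A`-th
vector field has the coordinate components `E z A`. -/
def comp (E : (Fin 4 → ℝ) → Matrix (Fin 4) (Fin 4) ℂ) {m : ℕ} (T : TensorField 4 m)
    (I : Fin m → Fin 4) (z : Fin 4 → ℝ) : ℂ :=
  ∑ a : Fin m → Fin 4, (∏ j, E z (I j) (a j)) * (T z a : ℂ)

section Comp

variable {E : (Fin 4 → ℝ) → Matrix (Fin 4) (Fin 4) ℂ} {m m' : ℕ} {z : Fin 4 → ℝ}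

theorem sum_fin_cons {α : Type*} [AddCommMonoid α] {n : ℕ} (F : (Fin (m + 1) → Fin n) → α) :
    ∑ a, F a = ∑ b, ∑ a : Fin m → Fin n, F (Fin.cons b a) := by
  rw [← Fintype.sum_prod_type']
  exact (Fintype.sum_equiv (Fin.consEquiv fun _ => Fin n) _ _ fun _ => rfl).symm

theorem sum_fin_append {α : Type*} [AddCommMonoid α] (F : (Fin (m + m') → Fin 4) → α) :
    ∑ a, F a = ∑ b : Fin m → Fin 4, ∑ c : Fin m' → Fin 4, F (Fin.append b c) := by
  rw [← Fintype.sum_prod_type']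
  exact (Fintype.sum_equiv (Fin.appendEquiv m m') _ _ fun _ => rfl).symm

theorem comp_add (T S : TensorField 4 m) (I : Fin m → Fin 4) :
    comp E (fun x a => T x a + S x a) I z = comp E T I z + comp E S I z := by
  simp only [comp, ← Finset.sum_add_distrib]
  exact Finset.sum_congr rfl fun a _ => by push_cast; ring

theorem comp_smul (f : (Fin 4 → ℝ) → ℝ) (T : TensorField 4 m) (I : Fin m → Fin 4) :
    comp E (fun x a => f x * T x a) I z = f z * comp E T I z := by
  simp only [comp, Finset.mul_sum]
  exact Finset.sum_congr rfl fun a _ => by push_cast; ring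

theorem comp_rank_zero (T : TensorField 4 0) (I : Fin 0 → Fin 4) :
    comp E T I z = T z Fin.elim0 := by
  rw [comp, Fintype.sum_subsingleton _ Fin.elim0]
  simp

theorem comp_tensorMul (T : TensorField 4 m) (S : TensorField 4 m') (I : Fin (m + m') → Fin 4) :
    comp E (tensorMul T S) I z
      = comp E T (fun i => I (Fin.castAdd m' i)) z * comp E S (fun i => I (Fin.natAdd m i)) z := by
  simp only [comp, sum_fin_append, Finset.sum_mul_sum, tensorMul]
  refine Finset.sum_congr rfl fun b _ => Finset.sum_congr rfl fun c _ => ?_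
  rw [Fin.prod_univ_add]
  simp only [Fin.append_left, Fin.append_right]
  push_cast; ring

theorem comp_relabel (σ : Fin m ≃ Fin m') (T : TensorField 4 m) (I : Fin m' → Fin 4) :
    comp E (fun x a => T x (a ∘ σ)) I z = comp E T (I ∘ σ) z := by
  simp only [comp]
  refine Fintype.sum_equiv (Equiv.arrowCongr σ.symm (Equiv.refl _)) _ _ fun a => ?_
  have h : (Equiv.arrowCongr σ.symm (Equiv.refl (Fin 4))) a = a ∘ σ := by ext; simp
  rw [h, ← Equiv.prod_comp σ]
  rfl

/-- A tensor is recovered from its frame components by means of the dual frame. -/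
theorem sum_coframe_mul_comp {θ : Matrix (Fin 4) (Fin 4) ℂ} (hθ : θ * E z = 1)
    (T : TensorField 4 m) (a : Fin m → Fin 4) :
    ∑ I : Fin m → Fin 4, (∏ j, θ (a j) (I j)) * comp E T I z = T z a := by
  simp only [comp, Finset.mul_sum]
  rw [Finset.sum_comm]
  have h : ∀ a' : Fin m → Fin 4, ∑ I : Fin m → Fin 4,
      (∏ j, θ (a j) (I j)) * ((∏ j, E z (I j) (a' j)) * (T z a' : ℂ))
        = if a = a' then (T z a' : ℂ) else 0 := fun a' => by
    have e : ∀ j, ∑ K, θ (a j) K * E z K (a' j) = if a j = a' j then 1 else 0 := fun j => by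
      rw [← Matrix.mul_apply, hθ, Matrix.one_apply]
    simp only [← mul_assoc, ← Finset.prod_mul_distrib]
    rw [← Finset.sum_mul, ← Fintype.prod_sum (fun j K => θ (a j) K * E z K (a' j))]
    simp only [e]
    by_cases haa : a = a'
    · simp [haa]
    · obtain ⟨j, hj⟩ := Function.ne_iff.1 haa
      rw [Finset.prod_eq_zero (Finset.mem_univ j) (by simp [hj])]
      simp [haa]
  simp [h]

theorem comp_contract {g : MetricField 4} {η : Matrix (Fin 4) (Fin 4) ℂ}
    (hη : ∀ c d, (((g z)⁻¹ c d : ℝ) : ℂ) = ∑ A, ∑ B, η A B * (E z A c * E z B d))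
    (T : TensorField 4 (m + 2)) (I : Fin m → Fin 4) :
    comp E (contract g T) I z
      = ∑ A, ∑ B, η A B * comp E T (Fin.cons A (Fin.cons B I : Fin (m + 1) → Fin 4)) z := by
  set Y : Fin 4 × Fin 4 → ℂ := fun q => ∑ a : Fin m → Fin 4, (∏ j, E z (I j) (a j)) *
    (T z (Fin.cons q.1 (Fin.cons q.2 a : Fin (m + 1) → Fin 4)) : ℂ) with hY
  have hl : comp E (contract g T) I z = ∑ q : Fin 4 × Fin 4,
      (((g z)⁻¹ q.1 q.2 : ℝ) : ℂ) * Y q := by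
    simp only [comp, contract, hY, Fintype.sum_prod_type, Finset.mul_sum]
    push_cast
    simp only [Finset.mul_sum]
    rw [Finset.sum_comm]
    refine Finset.sum_congr rfl fun c _ => ?_
    rw [Finset.sum_comm]
    exact Finset.sum_congr rfl fun d _ => Finset.sum_congr rfl fun a _ => by ring
  have hr : ∀ A B, comp E T (Fin.cons A (Fin.cons B I : Fin (m + 1) → Fin 4)) z
      = ∑ q : Fin 4 × Fin 4, (E z A q.1 * E z B q.2) * Y q := fun A B => by
    simp only [comp, sum_fin_cons, Fin.prod_univ_succ, Fin.cons_zero, Fin.cons_succ, hY,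
      Fintype.sum_prod_type, Finset.mul_sum]
    exact Finset.sum_congr rfl fun c _ => Finset.sum_congr rfl fun d _ =>
      Finset.sum_congr rfl fun a _ => by ring
  rw [hl]
  simp only [hr, hη, Finset.mul_sum, Finset.sum_mul]
  rw [Finset.sum_comm]
  refine Finset.sum_congr rfl fun A _ => ?_
  rw [Finset.sum_comm]
  exact Finset.sum_congr rfl fun B _ => Finset.sum_congr rfl fun q _ => by ring

theorem cpd_sum {ι : Type*} (t : Finset ι) {F : ι → (Fin 4 → ℝ) → ℂ} (i : Fin 4)
    (hF : ∀ a ∈ t, DifferentiableAt ℝ (F a) z) :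
    cpd i (fun w => ∑ a ∈ t, F a w) z = ∑ a ∈ t, cpd i (F a) z := by
  simp only [cpd]
  rw [fderiv_fun_sum hF]
  simp

theorem cpd_prod {ι : Type*} [DecidableEq ι] (t : Finset ι) {F : ι → (Fin 4 → ℝ) → ℂ} (i : Fin 4)
    (hF : ∀ a ∈ t, DifferentiableAt ℝ (F a) z) :
    cpd i (fun w => ∏ a ∈ t, F a w) z = ∑ a ∈ t, (∏ b ∈ t.erase a, F b z) * cpd i (F a) z := by
  have h := HasFDerivAt.finsetProd (u := t) (g := F) fun a ha => (hF a ha).hasFDerivAt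
  simp only [cpd]
  rw [h.fderiv]
  simp

theorem prod_update (I a : Fin m → Fin 4) (j : Fin m) (K : Fin 4)
    (X : Matrix (Fin 4) (Fin 4) ℂ) :
    ∏ i, X (Function.update I j K i) (a i)
      = X K (a j) * ∏ i ∈ Finset.univ.erase j, X (I i) (a i) := by
  rw [← Finset.mul_prod_erase _ _ (Finset.mem_univ j)]
  congr 1
  · simp
  · exact Finset.prod_congr rfl fun i hi => by
      rw [Function.update_of_ne (Finset.ne_of_mem_erase hi)]

theorem prod_update' (I a : Fin m → Fin 4) (j : Fin m) (K : Fin 4)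
    (X : Matrix (Fin 4) (Fin 4) ℂ) :
    ∏ i, X (I i) (Function.update a j K i)
      = X (I j) K * ∏ i ∈ Finset.univ.erase j, X (I i) (a i) := by
  rw [← Finset.mul_prod_erase _ _ (Finset.mem_univ j)]
  congr 1
  · simp
  · exact Finset.prod_congr rfl fun i hi => by
      rw [Function.update_of_ne (Finset.ne_of_mem_erase hi)]

/-- Exchanging the summed index of a Christoffel symbol with the index that it replaces. -/
theorem sum_update_swap (j : Fin m) (F : (Fin m → Fin 4) → Fin 4 → ℂ) :
    ∑ a, ∑ c, F a c = ∑ a : Fin m → Fin 4, ∑ d, F (Function.update a j d) (a j) := by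
  rw [← Fintype.sum_prod_type', ← Fintype.sum_prod_type']
  have hinv : Function.Involutive
      (fun p : (Fin m → Fin 4) × Fin 4 => (Function.update p.1 j p.2, p.1 j)) := fun p => by simp
  exact Fintype.sum_equiv hinv.toPerm _ _ fun p => by simp [Function.Involutive.toPerm]

/-- The frame components of a covariant derivative, in terms of the frame coefficients `γ` of the
connection, `∇_{e_J} e_A = ∑ K, γ J A K • e_K`. -/
theorem comp_covDeriv {g : MetricField 4} {γ : Fin 4 → Fin 4 → Fin 4 → ℂ}
    (hE : ∀ A c, DifferentiableAt ℝ (fun w => E w A c) z)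
    (hγ : ∀ J A c, ∑ b, E z J b * (cpd b (fun w => E w A c) z
      + ∑ d, (christoffel g z c b d : ℂ) * E z A d) = ∑ K, γ J A K * E z K c)
    {T : TensorField 4 m} (hT : ∀ a, DifferentiableAt ℝ (fun w => T w a) z)
    (J : Fin 4) (I : Fin m → Fin 4) :
    comp E (covDeriv g T) (Fin.cons J I) z
      = ∑ b, E z J b * cpd b (comp E T I) z
        - ∑ j, ∑ K, γ J (I j) K * comp E T (Function.update I j K) z := by
  set Q : Fin m → (Fin m → Fin 4) → ℂ :=
    fun j a => ∏ i ∈ Finset.univ.erase j, E z (I i) (a i) with hQ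
  have hTc : ∀ a, DifferentiableAt ℝ (fun w => (T w a : ℂ)) z := fun a =>
    Complex.ofRealCLM.differentiableAt.comp z (hT a)
  have hprod : ∀ a : Fin m → Fin 4, DifferentiableAt ℝ (fun w => ∏ j, E w (I j) (a j)) z :=
    fun a => (HasFDerivAt.finsetProd (u := Finset.univ) fun j _ =>
      (hE (I j) (a j)).hasFDerivAt).differentiableAt
  have hderiv : ∀ b, cpd b (comp E T I) z
      = ∑ a : Fin m → Fin 4, (∏ j, E z (I j) (a j)) * (pd b (fun w => T w a) z : ℂ)
        + ∑ j, ∑ a, Q j a * (T z a : ℂ) * cpd b (fun w => E w (I j) (a j)) z := fun b => by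
    have e : comp E T I = fun w => ∑ a : Fin m → Fin 4, (∏ j, E w (I j) (a j)) * (T w a : ℂ) := rfl
    rw [e, cpd_sum _ _ fun a _ => (hprod a).fun_mul (hTc a), Finset.sum_comm (s := Finset.univ)
      (t := Finset.univ) (f := fun j a => Q j a * (T z a : ℂ) * cpd b (fun w => E w (I j) (a j)) z),
      ← Finset.sum_add_distrib]
    refine Finset.sum_congr rfl fun a _ => ?_
    rw [cpd_mul _ (hprod a) (hTc a), cpd_prod _ _ fun j _ => hE (I j) (a j), cpd_ofReal _ (hT a),
      Finset.sum_mul, add_comm]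
    congr 1
    exact Finset.sum_congr rfl fun j _ => by rw [hQ]; ring
  have hchr : ∀ b, ∑ a : Fin m → Fin 4, (∏ j, E z (I j) (a j)) *
        ∑ j, ∑ c, (christoffel g z c b (a j) : ℂ) * (T z (Function.update a j c) : ℂ)
      = ∑ j, ∑ a, Q j a * (T z a : ℂ) * ∑ d, (christoffel g z (a j) b d : ℂ) * E z (I j) d :=
    fun b => by
    simp only [Finset.mul_sum]
    rw [Finset.sum_comm]
    refine Finset.sum_congr rfl fun j _ => ?_
    rw [sum_update_swap j]
    refine Finset.sum_congr rfl fun a _ => Finset.sum_congr rfl fun d _ => ?_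
    rw [prod_update']
    simp [hQ]
    ring
  have hrhs : ∀ j, ∑ K, γ J (I j) K * comp E T (Function.update I j K) z
      = ∑ a, Q j a * (T z a : ℂ) * ∑ K, γ J (I j) K * E z K (a j) := fun j => by
    simp only [comp, Finset.mul_sum, prod_update]
    rw [Finset.sum_comm]
    exact Finset.sum_congr rfl fun a _ => Finset.sum_congr rfl fun K _ => by rw [hQ]; ring
  have hlhs : comp E (covDeriv g T) (Fin.cons J I) z
      = ∑ b, E z J b * (∑ a : Fin m → Fin 4, (∏ j, E z (I j) (a j)) * (pd b (fun w => T w a) z : ℂ)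
        - ∑ a : Fin m → Fin 4, (∏ j, E z (I j) (a j)) *
          ∑ j, ∑ c, (christoffel g z c b (a j) : ℂ) * (T z (Function.update a j c) : ℂ)) := by
    rw [comp, sum_fin_cons]
    refine Finset.sum_congr rfl fun b _ => ?_
    rw [← Finset.sum_sub_distrib, Finset.mul_sum]
    refine Finset.sum_congr rfl fun a _ => ?_
    rw [Fin.prod_univ_succ]
    simp only [covDeriv, Fin.cons_zero, Fin.cons_succ, Fin.tail_cons]
    push_cast
    ring
  rw [hlhs]
  simp only [hchr, hderiv, hrhs, ← hγ]
  simp only [mul_add, mul_sub, Finset.sum_add_distrib, Finset.sum_sub_distrib, Finset.mul_sum]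
  have hs1 : ∀ F : Fin m → (Fin m → Fin 4) → Fin 4 → ℂ,
      ∑ j, ∑ a, ∑ b, F j a b = ∑ b, ∑ j, ∑ a, F j a b := fun F => by
    rw [Finset.sum_comm (s := (Finset.univ : Finset (Fin 4)))]
    exact Finset.sum_congr rfl fun j _ => Finset.sum_comm
  rw [hs1, hs1]
  have e1 : ∀ b j a, Q j a * (T z a : ℂ) * (E z J b * cpd b (fun w => E w (I j) (a j)) z)
      = E z J b * (Q j a * (T z a : ℂ) * cpd b (fun w => E w (I j) (a j)) z) := fun _ _ _ => by ring
  have e2 : ∀ b j a d, Q j a * (T z a : ℂ) *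
        (E z J b * ((christoffel g z (a j) b d : ℂ) * E z (I j) d))
      = E z J b * (Q j a * (T z a : ℂ) * ((christoffel g z (a j) b d : ℂ) * E z (I j) d)) :=
    fun _ _ _ _ => by ring
  simp only [e1, e2]
  ring

end Comp

/-! ### The null frame of the Kundt metric and its connection -/

/-- A real function of `(u, x, y)` as a complex function of the coordinates `(u, r, x, y)`. -/
def lift (f : ℝ × ℝ × ℝ → ℝ) (z : Fin 4 → ℝ) : ℂ := f (z 0, z 2, z 3)

/-- The null frame `∂_u - (λ r² + H) ∂_r`, `∂_r`, `P (∂_x - i ∂_y)`, `P (∂_x + i ∂_y)`. -/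
def kundtFrame (l k : ℝ) (H : ℝ × ℝ × ℝ → ℝ) (z : Fin 4 → ℝ) : Matrix (Fin 4) (Fin 4) ℂ :=
  !![1, -(l * (z 1 : ℂ) ^ 2 + lift H z), 0, 0;
     0, 1, 0, 0;
     0, 0, (kundtP k (z 2) (z 3) : ℂ), -Complex.I * (kundtP k (z 2) (z 3) : ℂ);
     0, 0, (kundtP k (z 2) (z 3) : ℂ), Complex.I * (kundtP k (z 2) (z 3) : ℂ)]

/-- The inverse matrix of `kundtFrame`, which expresses the coordinate vector fields in the null
frame. -/
def kundtCoframe (l k : ℝ) (H : ℝ × ℝ × ℝ → ℝ) (z : Fin 4 → ℝ) : Matrix (Fin 4) (Fin 4) ℂ :=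
  !![1, l * (z 1 : ℂ) ^ 2 + lift H z, 0, 0;
     0, 1, 0, 0;
     0, 0, (2 * (kundtP k (z 2) (z 3) : ℂ))⁻¹, (2 * (kundtP k (z 2) (z 3) : ℂ))⁻¹;
     0, 0, Complex.I * (2 * (kundtP k (z 2) (z 3) : ℂ))⁻¹,
       -Complex.I * (2 * (kundtP k (z 2) (z 3) : ℂ))⁻¹]

/-- The inverse metric in the null frame. -/
def frameInv : Matrix (Fin 4) (Fin 4) ℂ :=
  !![0, 1, 0, 0; 1, 0, 0, 0; 0, 0, 0, 1 / 2; 0, 0, 1 / 2, 0]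

/-- The metric in the null frame. -/
def frameMetric : Matrix (Fin 4) (Fin 4) ℂ :=
  !![0, 1, 0, 0; 1, 0, 0, 0; 0, 0, 0, 2; 0, 0, 2, 0]

/-- The level (minus the boost weight) of a frame index. -/
def levelWt : Fin 4 → ℤ := ![1, -1, 0, 0]

/-- The spin weight of a frame index. -/
def spinWt : Fin 4 → ℤ := ![0, 0, 1, -1]

/-- The part of the connection coefficients along the first frame vector that changes the frame
index. -/
def connOff (k : ℝ) (H : ℝ × ℝ × ℝ → ℝ) (z : Fin 4 → ℝ) : Matrix (Fin 4) (Fin 4) ℂ :=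
  !![0, 0, -(1 / 2) * nullD k (-1) (lift H) z, -(1 / 2) * nullD k 1 (lift H) z;
     0, 0, 0, 0;
     0, nullD k 1 (lift H) z, 0, 0;
     0, nullD k (-1) (lift H) z, 0, 0]

/-- The part of the connection coefficients that preserves the frame index: a boost and a
rotation. -/
def connDiag (l k : ℝ) (z : Fin 4 → ℝ) (J A : Fin 4) : ℂ :=
  (![-(2 * l * z 1 * levelWt A), 0, -(spinConn k 1 z * spinWt A),
    spinConn k (-1) z * spinWt A] : Fin 4 → ℂ) J

/-- The connection coefficients of the Kundt metric in the null frame. -/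
def kundtConn (l k : ℝ) (H : ℝ × ℝ × ℝ → ℝ) (z : Fin 4 → ℝ) (J A K : Fin 4) : ℂ :=
  (if K = A then connDiag l k z J A else 0) + (if J = 0 then connOff k H z A K else 0)

section Kundt

variable {l k : ℝ} {Ω : Set (ℝ × ℝ × ℝ)} {H f : ℝ × ℝ × ℝ → ℝ} {z : Fin 4 → ℝ}

theorem contDiff_kundtProj :
    ContDiff ℝ ∞ (fun z : Fin 4 → ℝ => (z 0, z 2, z 3)) :=
  (contDiff_apply ℝ ℝ 0).prodMk ((contDiff_apply ℝ ℝ 2).prodMk (contDiff_apply ℝ ℝ 3))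

theorem isOpen_kundtDomain (hΩ : IsOpen Ω) : IsOpen (kundtDomain Ω) :=
  hΩ.preimage contDiff_kundtProj.continuous

theorem contDiffOn_kundtProj (hf : ContDiffOn ℝ ∞ f Ω) :
    ContDiffOn ℝ ∞ (fun z : Fin 4 → ℝ => f (z 0, z 2, z 3)) (kundtDomain Ω) :=
  hf.comp contDiff_kundtProj.contDiffOn fun _ hz => hz

theorem rIndep_lift (hf : ContDiffOn ℝ ∞ f Ω) : RIndep (kundtDomain Ω) (lift f) :=
  ⟨Complex.ofRealCLM.contDiff.comp_contDiffOn (contDiffOn_kundtProj hf), fun z t => by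
    simp [lift]⟩

theorem coframe_mul_frame (hP : kundtP k (z 2) (z 3) ≠ 0) :
    kundtCoframe l k H z * kundtFrame l k H z = 1 := by
  have hP' : (kundtP k (z 2) (z 3) : ℂ) ≠ 0 := by exact_mod_cast hP
  ext i j
  fin_cases i <;> fin_cases j <;>
    simp [kundtCoframe, kundtFrame, Matrix.mul_apply, Fin.sum_univ_four] <;>
    field_simp <;> (try simp) <;> norm_num

theorem kundtMetric_inv (hP : kundtP k (z 2) (z 3) ≠ 0) :
    (kundtMetric l k H z)⁻¹ =
      !![0, 1, 0, 0;
         1, -(2 * (l * (z 1) ^ 2 + H (z 0, z 2, z 3))), 0, 0;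
         0, 0, kundtP k (z 2) (z 3) ^ 2, 0;
         0, 0, 0, kundtP k (z 2) (z 3) ^ 2] := by
  refine Matrix.inv_eq_right_inv ?_
  ext i j
  fin_cases i <;> fin_cases j <;>
    simp [kundtMetric, Matrix.mul_apply, Fin.sum_univ_four, hP]

theorem kundtMetric_inv_eq_frame (hP : kundtP k (z 2) (z 3) ≠ 0) (c d : Fin 4) :
    (((kundtMetric l k H z)⁻¹ c d : ℝ) : ℂ)
      = ∑ A, ∑ B, frameInv A B * (kundtFrame l k H z A c * kundtFrame l k H z B d) := by
  rw [kundtMetric_inv hP]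
  fin_cases c <;> fin_cases d <;>
    simp [frameInv, kundtFrame, Fin.sum_univ_four, lift] <;> (ring_nf; try simp)

theorem pd_lift_r (f : ℝ × ℝ × ℝ → ℝ) (hf : ContDiffOn ℝ ∞ f Ω) (hΩ : IsOpen Ω)
    (hz : z ∈ kundtDomain Ω) : pd 1 (fun w => f (w 0, w 2, w 3)) z = 0 := by
  have h := (rIndep_lift hf).cpd_one z
  have h' := cpd_ofReal 1
    ((contDiffOn_kundtProj hf).contDiffAt ((isOpen_kundtDomain hΩ).mem_nhds hz)
      |>.differentiableAt (by simp))
  exact_mod_cast h'.symm.trans h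

theorem pd_guu (hH : ContDiffOn ℝ ∞ H Ω) (hΩ : IsOpen Ω) (hz : z ∈ kundtDomain Ω) (i : Fin 4) :
    pd i (fun w => 2 * (l * (w 1) ^ 2 + H (w 0, w 2, w 3))) z
      = 2 * (2 * l * z 1 * (if i = 1 then 1 else 0) + pd i (fun w => H (w 0, w 2, w 3)) z) := by
  have hd := ((contDiffOn_kundtProj hH).contDiffAt ((isOpen_kundtDomain hΩ).mem_nhds hz)
      |>.differentiableAt (by simp)).hasFDerivAt
  have h1 : HasFDerivAt (fun w : Fin 4 → ℝ => w 1) (ContinuousLinearMap.proj 1) z :=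
    (ContinuousLinearMap.proj (R := ℝ) (φ := fun _ : Fin 4 => ℝ) 1).hasFDerivAt
  have h := (((h1.pow 2).const_mul l).add hd).const_mul 2
  have h' : HasFDerivAt (fun w : Fin 4 → ℝ => 2 * (l * (w 1) ^ 2 + H (w 0, w 2, w 3))) _ z := h
  rw [pd, h'.fderiv]
  by_cases hi : i = 1
  · subst hi; simp [pd]; ring
  · simp [pd, hi, Ne.symm hi]

theorem pd_kundtP_sq_inv (hP : kundtP k (z 2) (z 3) ≠ 0) (i : Fin 4) :
    pd i (fun w => ((kundtP k (w 2) (w 3)) ^ 2)⁻¹) z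
      = 4 * k * (z 2 * (if i = 2 then 1 else 0) + z 3 * (if i = 3 then 1 else 0))
        / kundtP k (z 2) (z 3) ^ 3 := by
  have h2 : HasFDerivAt (fun w : Fin 4 → ℝ => w 2) (ContinuousLinearMap.proj 2) z :=
    (ContinuousLinearMap.proj (R := ℝ) (φ := fun _ : Fin 4 => ℝ) 2).hasFDerivAt
  have h3 : HasFDerivAt (fun w : Fin 4 → ℝ => w 3) (ContinuousLinearMap.proj 3) z :=
    (ContinuousLinearMap.proj (R := ℝ) (φ := fun _ : Fin 4 => ℝ) 3).hasFDerivAt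
  have hPd : HasFDerivAt (fun w : Fin 4 → ℝ => kundtP k (w 2) (w 3)) _ z :=
    (((h2.pow 2).add (h3.pow 2)).const_mul k).const_sub 1
  have hinv : HasDerivAt (fun t : ℝ => (t ^ 2)⁻¹) _ (kundtP k (z 2) (z 3)) :=
    ((hasDerivAt_id (kundtP k (z 2) (z 3))).fun_pow 2).fun_inv (pow_ne_zero 2 hP)
  have h : HasFDerivAt (fun w : Fin 4 → ℝ => ((kundtP k (w 2) (w 3)) ^ 2)⁻¹) _ z :=
    HasDerivAt.comp_hasFDerivAt (f := fun w : Fin 4 → ℝ => kundtP k (w 2) (w 3)) z hinv hPd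
  rw [pd, h.fderiv]
  by_cases hi : i = 2
  · subst hi; simp; field_simp; ring
  · by_cases hi' : i = 3
    · subst hi'; simp; field_simp; ring
    · simp [hi, hi', Ne.symm hi, Ne.symm hi']

theorem pd_const (i : Fin 4) (c : ℝ) : pd i (fun _ => c) z = 0 := by simp [pd]

theorem kundt_christoffel (hΩ : IsOpen Ω) (hH : ContDiffOn ℝ ∞ H Ω) (hz : z ∈ kundtDomain Ω)
    (hP : kundtP k (z 2) (z 3) ≠ 0) (c a b : Fin 4) :
    christoffel (kundtMetric l k H) z c a b =
      (![!![-(2 * l * z 1), 0, 0, 0; 0, 0, 0, 0; 0, 0, 0, 0; 0, 0, 0, 0],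
        !![pd 0 (fun w => H (w 0, w 2, w 3)) z
            + 4 * (l * (z 1) ^ 2 + H (z 0, z 2, z 3)) * l * z 1, 2 * l * z 1,
            pd 2 (fun w => H (w 0, w 2, w 3)) z, pd 3 (fun w => H (w 0, w 2, w 3)) z;
          2 * l * z 1, 0, 0, 0;
          pd 2 (fun w => H (w 0, w 2, w 3)) z, 0, 0, 0;
          pd 3 (fun w => H (w 0, w 2, w 3)) z, 0, 0, 0],
        !![-(kundtP k (z 2) (z 3) ^ 2 * pd 2 (fun w => H (w 0, w 2, w 3)) z), 0, 0, 0;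
          0, 0, 0, 0;
          0, 0, 2 * k * z 2 / kundtP k (z 2) (z 3), 2 * k * z 3 / kundtP k (z 2) (z 3);
          0, 0, 2 * k * z 3 / kundtP k (z 2) (z 3), -(2 * k * z 2 / kundtP k (z 2) (z 3))],
        !![-(kundtP k (z 2) (z 3) ^ 2 * pd 3 (fun w => H (w 0, w 2, w 3)) z), 0, 0, 0;
          0, 0, 0, 0;
          0, 0, -(2 * k * z 3 / kundtP k (z 2) (z 3)), 2 * k * z 2 / kundtP k (z 2) (z 3);
          0, 0, 2 * k * z 2 / kundtP k (z 2) (z 3), 2 * k * z 3 / kundtP k (z 2) (z 3)]]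
        c) a b := by
  have h1 := pd_lift_r H hH hΩ hz
  have hg : ∀ i a b, pd i (fun w => kundtMetric l k H w a b) z
      = (!![2 * (2 * l * z 1 * (if i = 1 then 1 else 0) + pd i (fun w => H (w 0, w 2, w 3)) z),
            0, 0, 0;
          0, 0, 0, 0;
          0, 0, 4 * k * (z 2 * (if i = 2 then 1 else 0) + z 3 * (if i = 3 then 1 else 0))
            / kundtP k (z 2) (z 3) ^ 3, 0;
          0, 0, 0, 4 * k * (z 2 * (if i = 2 then 1 else 0) + z 3 * (if i = 3 then 1 else 0))
            / kundtP k (z 2) (z 3) ^ 3] : Matrix (Fin 4) (Fin 4) ℝ) a b := by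
    intro i a b
    rw [← pd_guu hH hΩ hz, ← pd_kundtP_sq_inv hP]
    fin_cases a <;> fin_cases b <;> simp [kundtMetric, pd_const]
  simp only [christoffel, hg, kundtMetric_inv hP, Fin.sum_univ_four]
  fin_cases c <;> fin_cases a <;> fin_cases b <;> simp [h1] <;> (try field_simp) <;> (try ring)

theorem differentiableAt_kundtFrame (hΩ : IsOpen Ω) (hH : ContDiffOn ℝ ∞ H Ω)
    (hz : z ∈ kundtDomain Ω) (A c : Fin 4) :
    DifferentiableAt ℝ (fun w => kundtFrame l k H w A c) z := by
  have hM := isOpen_kundtDomain hΩ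
  have dH := (rIndep_lift hH).1.differentiableAt_of_isOpen hM hz
  have dP := (rIndep_kundtP (M := kundtDomain Ω) (k := k)).1.differentiableAt_of_isOpen hM hz
  have dr := RPoly.differentiableAt_rpow 2 z
  have d1 := ((dr.const_mul (l : ℂ)).fun_add dH).fun_neg
  fin_cases A <;> fin_cases c <;> simp only [kundtFrame] <;>
    first
      | exact d1
      | exact differentiableAt_const _
      | exact dP
      | exact dP.const_mul _

theorem kundt_conn (hΩ : IsOpen Ω) (hH : ContDiffOn ℝ ∞ H Ω) (hz : z ∈ kundtDomain Ω)
    (hP : kundtP k (z 2) (z 3) ≠ 0) (J A c : Fin 4) :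
    ∑ b, kundtFrame l k H z J b * (cpd b (fun w => kundtFrame l k H w A c) z
      + ∑ d, (christoffel (kundtMetric l k H) z c b d : ℂ) * kundtFrame l k H z A d)
      = ∑ K, kundtConn l k H z J A K * kundtFrame l k H z K c := by
  have hM := isOpen_kundtDomain hΩ
  have hP' : (kundtP k (z 2) (z 3) : ℂ) ≠ 0 := by exact_mod_cast hP
  have dH := (rIndep_lift hH).1.differentiableAt_of_isOpen hM hz
  have dP := (rIndep_kundtP (M := kundtDomain Ω) (k := k)).1.differentiableAt_of_isOpen hM hz
  have dr := RPoly.differentiableAt_rpow 2 z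
  have hHr := (rIndep_lift hH).cpd_one z
  have hpd : ∀ i, ((pd i (fun w => H (w 0, w 2, w 3)) z : ℝ) : ℂ) = cpd i (lift H) z := fun i =>
    (cpd_ofReal i ((contDiffOn_kundtProj hH).contDiffAt (hM.mem_nhds hz)
      |>.differentiableAt (by simp))).symm
  have hE : ∀ b, cpd b (fun w => kundtFrame l k H w A c) z =
      (!![0, -(2 * l * z 1 * (if b = 1 then 1 else 0) + cpd b (lift H) z), 0, 0;
        0, 0, 0, 0;
        0, 0, cpd b (fun z => (kundtP k (z 2) (z 3) : ℂ)) z,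
          -Complex.I * cpd b (fun z => (kundtP k (z 2) (z 3) : ℂ)) z;
        0, 0, cpd b (fun z => (kundtP k (z 2) (z 3) : ℂ)) z,
          Complex.I * cpd b (fun z => (kundtP k (z 2) (z 3) : ℂ)) z] :
        Matrix (Fin 4) (Fin 4) ℂ) A c := fun b => by
    have e1 : cpd b (fun w => -(l * (w 1 : ℂ) ^ 2 + lift H w)) z
        = -(2 * l * z 1 * (if b = 1 then 1 else 0) + cpd b (lift H) z) := by
      have : (fun w : Fin 4 → ℝ => -(l * (w 1 : ℂ) ^ 2 + lift H w))
          = fun w => (-1) * (l * (w 1 : ℂ) ^ 2 + lift H w) := by funext w; ring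
      rw [this, cpd_const_mul _ _ ((dr.const_mul _).fun_add dH), cpd_add _ (dr.const_mul _) dH,
        cpd_const_mul _ _ dr, RPoly.cpd_rpow]
      split_ifs <;> (simp; try ring)
    rw [← e1, ← cpd_const_mul _ _ dP, ← cpd_const_mul _ _ dP]
    fin_cases A <;> fin_cases c <;> simp [kundtFrame, cpd_const]
  simp only [hE, cpd_kundtP, kundt_christoffel hΩ hH hz hP, Fin.sum_univ_four]
  fin_cases A <;> fin_cases c <;> simp [hpd, hHr, kundtFrame] <;>
  fin_cases J <;>
    simp [kundtConn, connDiag, connOff, levelWt, spinWt, spinConn, nullD, lift] <;>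
    (try field_simp) <;> (try ring_nf) <;> (try simp only [Complex.I_sq]) <;> (try ring_nf)

end Kundt

/-! ### Constructed tensors have admissible frame components -/

/-- The tensor fields all of whose components in the null frame are admissible, with the level and
the spin weight given by the frame indices. -/
def Balanced (l k : ℝ) (Ω : Set (ℝ × ℝ × ℝ)) (H φ : ℝ × ℝ × ℝ → ℝ) {m : ℕ}
    (T : TensorField 4 m) : Prop :=
  ∀ I : Fin m → Fin 4, Adm (kundtDomain Ω) (potentials k (lift φ)) (∑ j, levelWt (I j))
    (∑ j, spinWt (I j)) (comp (kundtFrame l k H) T I)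

theorem Adm.of_const {M : Set (Fin 4 → ℝ)} {Φ : ℤ → (Fin 4 → ℝ) → ℂ} {b s : ℤ}
    {f : (Fin 4 → ℝ) → ℂ} (c : ℂ) (hc : ¬(b = 0 ∧ s = 0) → c = 0) (h : ∀ z ∈ M, f z = c) :
    Adm M Φ b s f := by
  by_cases hbs : b = 0 ∧ s = 0
  · obtain ⟨rfl, rfl⟩ := hbs
    exact (Adm.const fun h => absurd rfl h).congr h
  · exact Adm.of_eq_zero fun z hz => by rw [h z hz, hc hbs]

theorem comp_rank_two {E : (Fin 4 → ℝ) → Matrix (Fin 4) (Fin 4) ℂ} (T : TensorField 4 2)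
    (I : Fin 2 → Fin 4) (z : Fin 4 → ℝ) :
    comp E T I z = ∑ c, ∑ d, E z (I 0) c * E z (I 1) d * (T z ![c, d] : ℂ) := by
  simp only [comp, sum_fin_cons, Fin.prod_univ_two, Fintype.sum_unique]
  exact Finset.sum_congr rfl fun c _ => Finset.sum_congr rfl fun d _ => by
    have h : ∀ e : Fin 0 → Fin 4,
        (Fin.cons c (Fin.cons d e : Fin 1 → Fin 4) : Fin 2 → Fin 4) = ![c, d] := fun e => by
      ext i; fin_cases i <;> rfl
    exact congrArg (fun v : Fin 2 → Fin 4 => E z (I 0) (v 0) * E z (I 1) (v 1) * (T z v : ℂ)) (h _)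

/-- The frame components of the Levi-Civita tensor are minors of the frame matrix. -/
theorem comp_volumeTensor {E : (Fin 4 → ℝ) → Matrix (Fin 4) (Fin 4) ℂ} (g : MetricField 4)
    (I : Fin 4 → Fin 4) (z : Fin 4 → ℝ) :
    comp E (volumeTensor g) I z = (√|(g z).det| : ℝ) * ((E z).submatrix I id).det := by
  have hrow : (E z).submatrix I id = fun i => ∑ c, E z (I i) c • (Pi.single c 1 : Fin 4 → ℂ) := by
    ext i j
    simp [Pi.single_apply]
  have hdet : ((E z).submatrix I id).det = ∑ a : Fin 4 → Fin 4,
      (∏ i, E z (I i) (a i)) *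
        (Matrix.of fun i j : Fin 4 => if a i = j then (1 : ℂ) else 0).det := by
    rw [hrow]
    have h := (Matrix.detRowAlternating (R := ℂ) (n := Fin 4)).toMultilinearMap.map_sum
      (fun i c => E z (I i) c • (Pi.single c 1 : Fin 4 → ℂ))
    refine h.trans (Finset.sum_congr rfl fun a _ => ?_)
    rw [MultilinearMap.map_smul_univ, smul_eq_mul]
    congr 1
    change Matrix.det _ = _
    congr 1
    ext i j
    simp [Pi.single_apply, eq_comm]
  rw [hdet, comp, Finset.mul_sum]
  refine Finset.sum_congr rfl fun a _ => ?_
  have hc : (((Matrix.of fun i j : Fin 4 => if a i = j then (1 : ℝ) else 0).det : ℝ) : ℂ)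
      = (Matrix.of fun i j : Fin 4 => if a i = j then (1 : ℂ) else 0).det := by
    rw [← Complex.ofRealHom_eq_coe, RingHom.map_det]
    congr 1
    ext i j
    by_cases h : a i = j <;> simp [h]
  rw [volumeTensor, Complex.ofReal_mul, hc]
  ring

section Balanced

variable {l k : ℝ} {Ω : Set (ℝ × ℝ × ℝ)} {H φ : ℝ × ℝ × ℝ → ℝ} {m m' : ℕ}

theorem balanced_metric (hP : ∀ z ∈ kundtDomain Ω, kundtP k (z 2) (z 3) ≠ 0) :
    Balanced l k Ω H φ (metricTensor (kundtMetric l k H)) := by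
  intro I
  refine Adm.of_const (frameMetric (I 0) (I 1)) ?_ fun z hz => ?_
  · simp only [Fin.sum_univ_two]
    generalize I 0 = A
    generalize I 1 = B
    fin_cases A <;> fin_cases B <;> simp [frameMetric, levelWt, spinWt]
  · have hP' : (kundtP k (z 2) (z 3) : ℂ) ≠ 0 := by exact_mod_cast hP z hz
    rw [comp_rank_two]
    generalize I 0 = A
    generalize I 1 = B
    fin_cases A <;> fin_cases B <;>
      simp [frameMetric, kundtFrame, metricTensor, kundtMetric, Fin.sum_univ_four, lift] <;>
      (try field_simp) <;> (try simp only [Complex.I_sq]) <;> (try ring)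

theorem det_kundtFrame (z : Fin 4 → ℝ) :
    (kundtFrame l k H z).det = 2 * Complex.I * (kundtP k (z 2) (z 3) : ℂ) ^ 2 := by
  simp [kundtFrame, Matrix.det_succ_row_zero, Fin.sum_univ_succ]
  ring

theorem sqrt_det_kundtMetric (z : Fin 4 → ℝ) :
    √|(kundtMetric l k H z).det| = (kundtP k (z 2) (z 3) ^ 2)⁻¹ := by
  have h : (kundtMetric l k H z).det = -((kundtP k (z 2) (z 3) ^ 2)⁻¹) ^ 2 := by
    simp [kundtMetric, Matrix.det_succ_row_zero, Fin.sum_univ_succ,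
      show Fin.succAbove (1 : Fin 4) 2 = 3 from rfl]
    ring
  rw [h, abs_neg, abs_of_nonneg (by positivity), Real.sqrt_sq (by positivity)]

theorem balanced_volume (hP : ∀ z ∈ kundtDomain Ω, kundtP k (z 2) (z 3) ≠ 0) :
    Balanced l k Ω H φ (volumeTensor (kundtMetric l k H)) := by
  intro I
  by_cases hI : Function.Injective I
  · obtain ⟨σ, rfl⟩ : ∃ σ : Equiv.Perm (Fin 4), I = σ :=
      ⟨Equiv.ofBijective I (Finite.injective_iff_bijective.1 hI), rfl⟩
    refine Adm.of_const (Equiv.Perm.sign σ * (2 * Complex.I)) (fun h => absurd ⟨?_, ?_⟩ h)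
      fun z hz => ?_
    · have hP' : (kundtP k (z 2) (z 3) : ℂ) ≠ 0 := by exact_mod_cast hP z hz
      rw [comp_volumeTensor, sqrt_det_kundtMetric, Matrix.det_permute, det_kundtFrame]
      push_cast
      field_simp
    · rw [Equiv.sum_comp σ levelWt]; simp [levelWt, Fin.sum_univ_four]
    · rw [Equiv.sum_comp σ spinWt]; simp [spinWt, Fin.sum_univ_four]
  · obtain ⟨i, j, hij, hne⟩ : ∃ i j, I i = I j ∧ i ≠ j := by
      simpa [Function.Injective] using hI
    refine Adm.of_eq_zero fun z _ => ?_
    rw [comp_volumeTensor, Matrix.det_zero_of_row_eq (M := (kundtFrame l k H z).submatrix I id) hne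
      (by ext; simp [hij]), mul_zero]

theorem kundtForm_apply (hΩ : IsOpen Ω) (hφ : ContDiffOn ℝ ∞ φ Ω) {z : Fin 4 → ℝ}
    (hz : z ∈ kundtDomain Ω) (a b : ℝ) (c d : Fin 4) :
    kundtForm a b k φ z ![c, d] =
      (!![0, a, pd 2 (fun w => φ (w 0, w 2, w 3)) z, pd 3 (fun w => φ (w 0, w 2, w 3)) z;
        -a, 0, 0, 0;
        -pd 2 (fun w => φ (w 0, w 2, w 3)) z, 0, 0, b * (kundtP k (z 2) (z 3) ^ 2)⁻¹;
        -pd 3 (fun w => φ (w 0, w 2, w 3)) z, 0, -(b * (kundtP k (z 2) (z 3) ^ 2)⁻¹), 0] :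
        Matrix (Fin 4) (Fin 4) ℝ) c d := by
  have h1 := pd_lift_r φ hφ hΩ hz
  have hd : ∀ i : Fin 4, extD (scalarField fun w : Fin 4 → ℝ => φ (w 0, w 2, w 3)) z ![i]
      = pd i (fun w => φ (w 0, w 2, w 3)) z := fun i => by
    simp [extD, scalarField]
  simp only [kundtForm, wedge, coordForm, Matrix.cons_val_zero, Matrix.cons_val_one, hd]
  fin_cases c <;> fin_cases d <;> simp [h1]

theorem balanced_kundtForm (hΩ : IsOpen Ω) (hP : ∀ z ∈ kundtDomain Ω, kundtP k (z 2) (z 3) ≠ 0)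
    (hφ : ContDiffOn ℝ ∞ φ Ω) (a b : ℝ) : Balanced l k Ω H φ (kundtForm a b k φ) := by
  have hM := isOpen_kundtDomain hΩ
  have hpd : ∀ z ∈ kundtDomain Ω, ∀ i,
      ((pd i (fun w => φ (w 0, w 2, w 3)) z : ℝ) : ℂ) = cpd i (lift φ) z := fun z hz i =>
    (cpd_ofReal i ((contDiffOn_kundtProj hφ).contDiffAt (hM.mem_nhds hz)
      |>.differentiableAt (by simp))).symm
  intro I
  obtain ⟨A, B, rfl⟩ : ∃ A B, I = ![A, B] := ⟨I 0, I 1, by ext i; fin_cases i <;> rfl⟩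
  -- The frame components; those with one index `0` carry the first spin-weighted derivatives.
  have key : ∀ z ∈ kundtDomain Ω, comp (kundtFrame l k H) (kundtForm a b k φ) ![A, B] z
      = (!![0, (a : ℂ), potentials k (lift φ) 1 z, potentials k (lift φ) (-1) z;
          -a, 0, 0, 0;
          -potentials k (lift φ) 1 z, 0, 0, 2 * Complex.I * b;
          -potentials k (lift φ) (-1) z, 0, -(2 * Complex.I * b), 0] :
          Matrix (Fin 4) (Fin 4) ℂ) A B := by
    intro z hz
    have hP' : (kundtP k (z 2) (z 3) : ℂ) ≠ 0 := by exact_mod_cast hP z hz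
    simp only [comp_rank_two, kundtForm_apply hΩ hφ hz]
    fin_cases A <;> fin_cases B <;>
      simp [kundtFrame, Fin.sum_univ_four, hpd z hz, potentials, potential, nullD] <;>
      (try field_simp) <;> (try ring)
  refine Adm.congr ?_ key
  have h1 : ∀ s c, Adm (kundtDomain Ω) (potentials k (lift φ)) 1 s
      (fun z => c * potentials k (lift φ) s z) := fun s c => by
    have h := Adm.of_succ (M := kundtDomain Ω) (Φ := potentials k (lift φ)) (s := s) 0 c
      RPoly.zero (f := fun z => c * potentials k (lift φ) s z) fun z _ => by simp
    simpa using h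
  have h2 := fun s => (h1 s 1).congr (g := potentials k (lift φ) s) fun z _ => by simp
  have h3 := fun s => (h1 s (-1)).congr (g := fun z => -potentials k (lift φ) s z)
    fun z _ => by simp
  have hc : ∀ c : ℂ, Adm (kundtDomain Ω) (potentials k (lift φ)) 0 0 (fun _ => c) := fun c =>
    Adm.const fun h => absurd rfl h
  simp only [Fin.sum_univ_two, Matrix.cons_val_zero, Matrix.cons_val_one]
  fin_cases A <;> fin_cases B <;> simp only [levelWt, spinWt] <;>
    first
      | exact Adm.zero
      | exact hc _
      | exact h2 _
      | exact h3 _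

theorem Balanced.tensorMul (hΦ : ∀ s, RIndep (kundtDomain Ω) (potentials k (lift φ) s))
    {T : TensorField 4 m} {S : TensorField 4 m'} (hT : Balanced l k Ω H φ T)
    (hS : Balanced l k Ω H φ S) : Balanced l k Ω H φ (tensorMul T S) := by
  intro I
  rw [Fin.sum_univ_add, Fin.sum_univ_add]
  exact ((hT _).mul hΦ (hS _)).congr fun z _ => comp_tensorMul T S I

theorem Balanced.add {T S : TensorField 4 m} (hT : Balanced l k Ω H φ T)
    (hS : Balanced l k Ω H φ S) : Balanced l k Ω H φ (fun x a => T x a + S x a) := fun I =>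
  ((hT I).add (hS I)).congr fun _ _ => comp_add T S I

theorem Balanced.relabel (σ : Fin m ≃ Fin m') {T : TensorField 4 m}
    (hT : Balanced l k Ω H φ T) : Balanced l k Ω H φ (fun x a => T x (a ∘ σ)) := by
  intro I
  rw [← Equiv.sum_comp σ, ← Equiv.sum_comp σ]
  exact (hT (I ∘ σ)).congr fun z _ => comp_relabel σ T I

theorem Balanced.smul_of_const {f : (Fin 4 → ℝ) → ℝ} {c : ℝ} (hf : ∀ z ∈ kundtDomain Ω, f z = c)
    {T : TensorField 4 m} (hT : Balanced l k Ω H φ T) :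
    Balanced l k Ω H φ (fun x a => f x * T x a) := fun I =>
  ((hT I).const_mul c).congr fun z hz => by rw [comp_smul, hf z hz]

theorem Balanced.contract (hP : ∀ z ∈ kundtDomain Ω, kundtP k (z 2) (z 3) ≠ 0)
    {T : TensorField 4 (m + 2)} (hT : Balanced l k Ω H φ T) :
    Balanced l k Ω H φ (contract (kundtMetric l k H) T) := by
  intro I
  refine Adm.congr ?_ fun z hz => comp_contract (fun c d => kundtMetric_inv_eq_frame (hP z hz) c d)
    T I
  refine Adm.sum _ fun A _ => Adm.sum _ fun B _ => ?_
  by_cases h0 : frameInv A B = 0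
  · exact Adm.of_eq_zero fun z _ => by rw [h0, zero_mul]
  · have hw : levelWt A + levelWt B = 0 ∧ spinWt A + spinWt B = 0 := by
      revert h0
      fin_cases A <;> fin_cases B <;> simp [frameInv, levelWt, spinWt]
    have h := hT (Fin.cons A (Fin.cons B I : Fin (m + 1) → Fin 4))
    simp only [Fin.sum_univ_succ (n := m + 1), Fin.sum_univ_succ (n := m), Fin.cons_zero,
      Fin.cons_succ, ← add_assoc] at h
    rw [hw.1, hw.2, zero_add, zero_add] at h
    exact h.const_mul _

theorem differentiableAt_kundtCoframe (hΩ : IsOpen Ω) (hH : ContDiffOn ℝ ∞ H Ω)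
    {z : Fin 4 → ℝ} (hz : z ∈ kundtDomain Ω) (hP : kundtP k (z 2) (z 3) ≠ 0) (c A : Fin 4) :
    DifferentiableAt ℝ (fun w => kundtCoframe l k H w c A) z := by
  have hM := isOpen_kundtDomain hΩ
  have hP' : (2 * kundtP k (z 2) (z 3) : ℂ) ≠ 0 := by exact_mod_cast mul_ne_zero two_ne_zero hP
  have dH := (rIndep_lift hH).1.differentiableAt_of_isOpen hM hz
  have dP := (rIndep_kundtP (M := kundtDomain Ω) (k := k)).1.differentiableAt_of_isOpen hM hz
  have dPi := (dP.const_mul 2).fun_inv hP'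
  have dr := RPoly.differentiableAt_rpow 2 z
  have d1 := (dr.const_mul (l : ℂ)).fun_add dH
  fin_cases c <;> fin_cases A <;> simp only [kundtCoframe] <;>
    first
      | exact d1
      | exact differentiableAt_const _
      | exact dPi
      | exact dPi.const_mul _

theorem Balanced.differentiableAt (hΩ : IsOpen Ω) (hH : ContDiffOn ℝ ∞ H Ω)
    (hP : ∀ z ∈ kundtDomain Ω, kundtP k (z 2) (z 3) ≠ 0)
    (hΦ : ∀ s, RIndep (kundtDomain Ω) (potentials k (lift φ) s))
    {T : TensorField 4 m} (hT : Balanced l k Ω H φ T) {z : Fin 4 → ℝ} (hz : z ∈ kundtDomain Ω)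
    (a : Fin m → Fin 4) : DifferentiableAt ℝ (fun w => T w a) z := by
  have hM := isOpen_kundtDomain hΩ
  have h : DifferentiableAt ℝ (fun w => ∑ I : Fin m → Fin 4,
      (∏ j, kundtCoframe l k H w (a j) (I j)) * comp (kundtFrame l k H) T I w) z := by
    refine DifferentiableAt.fun_sum fun I _ => DifferentiableAt.fun_mul ?_
      (((hT I).contDiffOn hΦ).differentiableAt_of_isOpen hM hz)
    exact (HasFDerivAt.finsetProd (u := Finset.univ) fun j _ =>
      (differentiableAt_kundtCoframe (l := l) hΩ hH hz (hP z hz) (a j)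
        (I j)).hasFDerivAt).differentiableAt
  have h' := Complex.reCLM.differentiableAt.comp z h
  refine h'.congr_of_eventuallyEq (Filter.eventually_of_mem (hM.mem_nhds hz) fun w hw => ?_)
  simp only [Function.comp, sum_coframe_mul_comp (coframe_mul_frame (hP w hw)) T a]
  simp

theorem Balanced.covDeriv (hΩ : IsOpen Ω) (hH : ContDiffOn ℝ ∞ H Ω)
    (hP : ∀ z ∈ kundtDomain Ω, kundtP k (z 2) (z 3) ≠ 0)
    (hφ : ContDiffOn ℝ ∞ φ Ω)
    (hharm : ∀ z ∈ kundtDomain Ω,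
      cpd 2 (cpd 2 (lift φ)) z + cpd 3 (cpd 3 (lift φ)) z = 0)
    {T : TensorField 4 m} (hT : Balanced l k Ω H φ T) :
    Balanced l k Ω H φ (covDeriv (kundtMetric l k H) T) := by
  have hM := isOpen_kundtDomain hΩ
  have hΦ : ∀ s, RIndep (kundtDomain Ω) (potentials k (lift φ) s) := fun s =>
    rIndep_potentials hM (rIndep_lift hφ) s
  intro I'
  obtain ⟨J, I, rfl⟩ : ∃ J I, I' = Fin.cons J I := ⟨I' 0, Fin.tail I', (Fin.cons_self_tail I').symm⟩
  simp only [Fin.sum_univ_succ, Fin.cons_zero, Fin.cons_succ]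
  set b := ∑ j, levelWt (I j) with hb
  set s := ∑ j, spinWt (I j) with hs
  set f := comp (kundtFrame l k H) T I with hf
  have hfI : Adm (kundtDomain Ω) (potentials k (lift φ)) b s f := hT I
  have key : ∀ z ∈ kundtDomain Ω,
      comp (kundtFrame l k H) (EMField.covDeriv (kundtMetric l k H) T) (Fin.cons J I) z
        = ∑ c, kundtFrame l k H z J c * cpd c f z - (∑ j, connDiag l k z J (I j)) * f z
          - (if J = 0 then ∑ j, ∑ K, connOff k H z (I j) K *
              comp (kundtFrame l k H) T (Function.update I j K) z else 0) := fun z hz => by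
    rw [comp_covDeriv (fun A c => differentiableAt_kundtFrame hΩ hH hz A c)
      (fun J A c => kundt_conn hΩ hH hz (hP z hz) J A c)
      (fun a => hT.differentiableAt hΩ hH hP hΦ hz a), sub_sub]
    congr 1
    simp only [kundtConn, add_mul, Finset.sum_add_distrib, ite_mul, zero_mul, Finset.sum_ite_eq',
      Finset.mem_univ, if_true, Function.update_eq_self, Finset.sum_mul]
    congr 1
    split_ifs <;> simp
  refine Adm.congr ?_ key
  have hdiag : ∀ z, ∑ j, connDiag l k z J (I j)
      = (![-(2 * l * z 1 * b), 0, -(spinConn k 1 z * s), spinConn k (-1) z * s] : Fin 4 → ℂ) J := by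
    intro z
    rw [hb, hs]
    fin_cases J <;> simp [connDiag, Finset.mul_sum]
  simp only [hdiag]
  have hδ1 : (1 : ℤ) * 1 = 1 := rfl
  have hδ2 : (-1 : ℤ) * -1 = 1 := rfl
  fin_cases J
  · have h1 := hfI.boostD (l := l) hM hΦ (rIndep_lift hH)
    have h2 : Adm (kundtDomain Ω) (potentials k (lift φ)) (b + 1) s (fun z => ∑ j, ∑ K,
        connOff k H z (I j) K * comp (kundtFrame l k H) T (Function.update I j K) z) := by
      refine Adm.sum _ fun j _ => Adm.sum _ fun K _ => ?_
      -- A connection coefficient that changes the index raises the total level by two.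
      have hoff : RIndep (kundtDomain Ω) (fun z => connOff k H z (I j) K) ∧
          (levelWt K = levelWt (I j) - 1 ∨ ∀ z, connOff k H z (I j) K = 0) := by
        have e1 : RIndep (kundtDomain Ω) (nullD k 1 (lift H)) := (rIndep_lift hH).nullD hM
        have e2 : RIndep (kundtDomain Ω) (nullD k (-1) (lift H)) := (rIndep_lift hH).nullD hM
        generalize I j = A
        constructor
        · fin_cases A <;> fin_cases K <;> simp only [connOff] <;>
            first
              | exact RIndep.const 0
              | exact e1
              | exact e2
              | exact (RIndep.const _).mul e1
              | exact (RIndep.const _).mul e2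
        · fin_cases A <;> fin_cases K <;> simp [connOff, levelWt]
      rcases hoff.2 with hw | h0
      · have hlev : ∑ i, levelWt (Function.update I j K i) = b - 1 := by
          rw [hb, ← Finset.add_sum_erase _ _ (Finset.mem_univ j),
            ← Finset.add_sum_erase _ (fun i => levelWt (I i)) (Finset.mem_univ j),
            Function.update_self, hw]
          have : ∑ i ∈ Finset.univ.erase j, levelWt (Function.update I j K i)
              = ∑ i ∈ Finset.univ.erase j, levelWt (I i) :=
            Finset.sum_congr rfl fun i hi => by
              rw [Function.update_of_ne (Finset.ne_of_mem_erase hi)]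
          rw [this]; ring
        have h := (hT (Function.update I j K)).rIndep_mul (s' := s) hΦ hoff.1
        rw [hlev, show b - 1 + 2 = b + 1 by ring] at h
        exact h
      · exact Adm.of_eq_zero fun z _ => by rw [h0, zero_mul]
    have h3 := h1.sub h2
    have e : levelWt 0 + b = b + 1 := by simp [levelWt, add_comm]
    have e' : spinWt 0 + s = s := by simp [spinWt]
    simp only [Fin.zero_eta, e, e']
    refine h3.congr fun z _ => ?_
    simp [kundtFrame, Fin.sum_univ_four]
    ring
  · have h1 := hfI.cpd_one hM hΦ
    have e : levelWt 1 + b = b - 1 := by simp [levelWt]; ring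
    have e' : spinWt 1 + s = s := by simp [spinWt]
    simp only [Fin.mk_one, e, e']
    refine h1.congr fun z _ => ?_
    simp [kundtFrame, Fin.sum_univ_four]
  · have h1 := hfI.eth hM hΦ (eth_potentials (k := k) hM (rIndep_lift hφ) hharm hδ1)
    have e : levelWt 2 + b = b := by simp [levelWt]
    have e' : spinWt 2 + s = s + 1 := by simp [spinWt]; ring
    simp only [Fin.reduceFinMk, e, e']
    refine h1.congr fun z _ => ?_
    simp [kundtFrame, Fin.sum_univ_four, eth, nullD]
    ring
  · have h1 := hfI.eth hM hΦ (eth_potentials (k := k) hM (rIndep_lift hφ) hharm hδ2)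
    have e : levelWt 3 + b = b := by simp [levelWt]
    have e' : spinWt 3 + s = s + -1 := by simp [spinWt]; ring
    simp only [Fin.reduceFinMk, e, e']
    refine h1.congr fun z _ => ?_
    simp [kundtFrame, Fin.sum_univ_four, eth, nullD]
    ring

/-- All tensor fields constructed from the Kundt form are balanced. In particular their scalar
invariants are constant, so that the coefficient functions only contribute constants. -/
theorem Constructed.balanced (hΩ : IsOpen Ω) (hH : ContDiffOn ℝ ∞ H Ω)
    (hP : ∀ z ∈ kundtDomain Ω, kundtP k (z 2) (z 3) ≠ 0) (hφ : ContDiffOn ℝ ∞ φ Ω)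
    (hharm : ∀ z ∈ kundtDomain Ω,
      cpd 2 (cpd 2 (lift φ)) z + cpd 3 (cpd 3 (lift φ)) z = 0) {a b : ℝ}
    {T : TensorField 4 m}
    (hT : Constructed (kundtMetric l k H) (kundtDomain Ω) (kundtForm a b k φ) T) :
    Balanced l k Ω H φ T := by
  have hΦ : ∀ s, RIndep (kundtDomain Ω) (potentials k (lift φ) s) := fun s =>
    rIndep_potentials (isOpen_kundtDomain hΩ) (rIndep_lift hφ) s
  induction hT with
  | field => exact balanced_kundtForm hΩ hP hφ a b
  | metric => exact balanced_metric hP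
  | volume => exact balanced_volume hP
  | cov _ ih => exact ih.covDeriv hΩ hH hP hφ hharm
  | mul _ _ ih1 ih2 => exact ih1.tensorMul hΦ ih2
  | contr _ ih => exact ih.contract hP
  | relabel σ _ ih => exact ih.relabel σ
  | add _ _ ih1 ih2 => exact ih1.add ih2
  | @coeff p q S V f T _ _ _ _ _ ihS ihT =>
    rcases (kundtDomain Ω).eq_empty_or_nonempty with he | ⟨z₀, hz₀⟩
    · exact fun I => by rw [he]; exact Adm.of_eq_zero fun z hz => absurd hz (Set.notMem_empty z)
    · refine Balanced.smul_of_const (c := f fun i => S i z₀ Fin.elim0) (fun z hz => ?_) ihT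
      congr 1
      funext i
      obtain ⟨c, -, hc⟩ := (ihS i Fin.elim0).2.1 (by simp)
      have h1 := hc z hz
      have h2 := hc z₀ hz₀
      rw [comp_rank_zero] at h1 h2
      exact_mod_cast h1.trans h2.symm

end Balanced

/-! ### The transverse Laplacian -/

section Transverse

variable {k : ℝ} {f g : (Fin 2 → ℝ) → ℝ} {U : Set (Fin 2 → ℝ)} {x : Fin 2 → ℝ}

theorem pd_congr {n : ℕ} {U : Set (Fin n → ℝ)} {f g : (Fin n → ℝ) → ℝ} {x : Fin n → ℝ}
    (hU : IsOpen U) (hx : x ∈ U) (h : ∀ w ∈ U, f w = g w) (i : Fin n) : pd i f x = pd i g x := by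
  have : f =ᶠ[nhds x] g := Filter.eventually_of_mem (hU.mem_nhds hx) h
  simp [pd, this.fderiv_eq]

theorem volumeTensor_transverse (i j : Fin 2) :
    volumeTensor (transverseMetric k) x ![i, j]
      = (kundtP k (x 0) (x 1) ^ 2)⁻¹ * (!![0, 1; -1, 0] : Matrix (Fin 2) (Fin 2) ℝ) i j := by
  have h : (transverseMetric k x).det = ((kundtP k (x 0) (x 1) ^ 2)⁻¹) ^ 2 := by
    simp [transverseMetric, Matrix.det_fin_two]; ring
  rw [volumeTensor, h, abs_of_nonneg (by positivity), Real.sqrt_sq (by positivity)]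
  congr 1
  fin_cases i <;> fin_cases j <;> simp [Matrix.det_fin_two]

theorem transverseMetric_inv (hP : kundtP k (x 0) (x 1) ≠ 0) :
    (transverseMetric k x)⁻¹ = !![kundtP k (x 0) (x 1) ^ 2, 0; 0, kundtP k (x 0) (x 1) ^ 2] := by
  refine Matrix.inv_eq_right_inv ?_
  ext i j
  fin_cases i <;> fin_cases j <;> simp [transverseMetric, Matrix.mul_apply, hP]

theorem hodge_transverse_one (hP : kundtP k (x 0) (x 1) ≠ 0) (A : TensorField 2 1) (b : Fin 2) :
    hodge (show 1 + 1 = 2 from rfl) (transverseMetric k) A x ![b]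
      = (![-A x ![1], A x ![0]] : Fin 2 → ℝ) b := by
  have hv : ∀ c : Fin 2, volumeTensor (transverseMetric k) x
      (fun i => Fin.append ![c] ![b] (Fin.cast (show 1 + 1 = 2 from rfl).symm i))
        = (kundtP k (x 0) (x 1) ^ 2)⁻¹ * (!![0, 1; -1, 0] : Matrix (Fin 2) (Fin 2) ℝ) c b :=
    fun c => by
      rw [← volumeTensor_transverse]
      congr 1
      ext i
      fin_cases i <;> rfl
  have hsum : ∀ F : (Fin 1 → Fin 2) → ℝ, ∑ a, F a = F ![0] + F ![1] := fun F => by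
    rw [sum_fin_cons, Fin.sum_univ_two]
    simp only [Fintype.sum_unique]
    congr 1
  simp only [hodge, hsum, hv, transverseMetric_inv hP]
  fin_cases b <;> simp <;> field_simp

theorem hodge_transverse_two (hP : kundtP k (x 0) (x 1) ≠ 0) (A : TensorField 2 2) :
    hodge (show 2 + 0 = 2 from rfl) (transverseMetric k) A x Fin.elim0
      = kundtP k (x 0) (x 1) ^ 2 * ((A x ![0, 1] - A x ![1, 0]) / 2) := by
  have hv : ∀ c d : Fin 2, volumeTensor (transverseMetric k) x
      (fun i => Fin.append ![c, d] Fin.elim0 (Fin.cast (show 2 + 0 = 2 from rfl).symm i))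
        = (kundtP k (x 0) (x 1) ^ 2)⁻¹ * (!![0, 1; -1, 0] : Matrix (Fin 2) (Fin 2) ℝ) c d :=
    fun c d => by
      rw [← volumeTensor_transverse]
      congr 1
      ext i
      fin_cases i <;> rfl
  have hsum : ∀ F : (Fin 2 → Fin 2) → ℝ,
      ∑ a, F a = F ![0, 0] + F ![0, 1] + (F ![1, 0] + F ![1, 1]) := fun F => by
    have h : ∀ (c d : Fin 2) (e : Fin 0 → Fin 2),
        (Fin.cons c (Fin.cons d e : Fin 1 → Fin 2) : Fin 2 → Fin 2) = ![c, d] := fun c d e => by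
      ext i; fin_cases i <;> rfl
    simp only [sum_fin_cons, Fin.sum_univ_two, Fintype.sum_unique]
    exact congrArg₂ _ (congrArg₂ _ (congrArg F (h _ _ _)) (congrArg F (h _ _ _)))
      (congrArg₂ _ (congrArg F (h _ _ _)) (congrArg F (h _ _ _)))
  simp only [hodge, hsum, hv, transverseMetric_inv hP]
  simp
  field_simp
  ring

theorem extD_scalarField {n : ℕ} (f : (Fin n → ℝ) → ℝ) (x : Fin n → ℝ) (i : Fin n) :
    extD (scalarField f) x ![i] = pd i f x := by
  simp [extD, scalarField]

theorem extD_one {n : ℕ} (A : TensorField n 1) (x : Fin n → ℝ) (i j : Fin n) :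
    extD A x ![i, j] = pd i (fun y => A y ![j]) x - pd j (fun y => A y ![i]) x := by
  have h0 : (fun l : Fin 1 => (![i, j] : Fin 2 → Fin n) ((0 : Fin 2).succAbove l)) = ![j] := by
    ext l; fin_cases l; rfl
  have h1 : (fun l : Fin 1 => (![i, j] : Fin 2 → Fin n) ((1 : Fin 2).succAbove l)) = ![i] := by
    ext l; fin_cases l; rfl
  calc extD A x ![i, j]
      = (-1) ^ 0 * pd i (fun y => A y fun l : Fin 1 => ![i, j] ((0 : Fin 2).succAbove l)) x
        + (-1) ^ 1 * pd j (fun y => A y fun l : Fin 1 => ![i, j] ((1 : Fin 2).succAbove l)) x :=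
        Fin.sum_univ_two _
    _ = _ := by rw [h0, h1]; ring

theorem transverseBox_eq (hU : IsOpen U) (hP : ∀ w ∈ U, kundtP k (w 0) (w 1) ≠ 0) (hx : x ∈ U)
    (f : (Fin 2 → ℝ) → ℝ) :
    transverseBox k f x
      = -(kundtP k (x 0) (x 1) ^ 2 * (pd 0 (pd 0 f) x + pd 1 (pd 1 f) x)) := by
  have hB : ∀ i b, pd i (fun y => hodge (show 1 + 1 = 2 from rfl) (transverseMetric k)
      (extD (scalarField f)) y ![b]) x = pd i (fun y => (![-pd 1 f y, pd 0 f y] : Fin 2 → ℝ) b) x :=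
    fun i b => pd_congr hU hx (fun w hw => by
      rw [hodge_transverse_one (hP w hw), extD_scalarField, extD_scalarField]) i
  have hneg : pd 1 (fun y => -pd 1 f y) x = -pd 1 (pd 1 f) x := by
    have h : fderiv ℝ (fun y => -pd 1 f y) x = -fderiv ℝ (pd 1 f) x := fderiv_fun_neg
    rw [pd, h]
    rfl
  rw [transverseBox, hodge_transverse_two (hP x hx), extD_one, extD_one, hB, hB]
  simp only [Matrix.cons_val_zero, Matrix.cons_val_one, hneg]
  ring

end Transverse

section Harmonic

variable {k : ℝ} {Ω : Set (ℝ × ℝ × ℝ)} {φ : ℝ × ℝ × ℝ → ℝ}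

/-- The inclusion of a transverse surface of constant `u` and `r`. -/
def transverseEmbed (u r : ℝ) (w : Fin 2 → ℝ) : Fin 4 → ℝ := ![u, r, w 0, w 1]

theorem contDiff_transverseEmbed (u r : ℝ) : ContDiff ℝ ∞ (transverseEmbed u r) := by
  rw [contDiff_pi]
  intro i
  fin_cases i
  · exact contDiff_const
  · exact contDiff_const
  · exact contDiff_apply ℝ ℝ 0
  · exact contDiff_apply ℝ ℝ 1

theorem pd_comp_transverseEmbed {g : (Fin 4 → ℝ) → ℝ} {u r : ℝ} {w : Fin 2 → ℝ}
    (hg : DifferentiableAt ℝ g (transverseEmbed u r w)) (i : Fin 2) :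
    pd i (fun w => g (transverseEmbed u r w)) w
      = pd (Fin.natAdd 2 i) g (transverseEmbed u r w) := by
  have hι : HasFDerivAt (transverseEmbed u r) (ContinuousLinearMap.pi
      (![0, 0, ContinuousLinearMap.proj 0, ContinuousLinearMap.proj 1] :
        Fin 4 → (Fin 2 → ℝ) →L[ℝ] ℝ)) w := by
    rw [hasFDerivAt_pi']
    intro i
    fin_cases i
    · exact hasFDerivAt_const u w
    · exact hasFDerivAt_const r w
    · exact (ContinuousLinearMap.proj (R := ℝ) (φ := fun _ : Fin 2 => ℝ) 0).hasFDerivAt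
    · exact (ContinuousLinearMap.proj (R := ℝ) (φ := fun _ : Fin 2 => ℝ) 1).hasFDerivAt
  have h : HasFDerivAt (fun w => g (transverseEmbed u r w)) _ w := hg.hasFDerivAt.comp w hι
  rw [pd, pd, h.fderiv, ContinuousLinearMap.comp_apply]
  congr 1
  ext j
  fin_cases i <;> fin_cases j <;> simp

theorem harmonic_lift (hΩ : IsOpen Ω)
    (hP : ∀ u x y : ℝ, (u, x, y) ∈ Ω → kundtP k x y ≠ 0) (hφ : ContDiffOn ℝ ∞ φ Ω)
    (hbox : ∀ u x y : ℝ, (u, x, y) ∈ Ω →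
      transverseBox k (fun z => φ (u, z 0, z 1)) ![x, y] = 0)
    {z : Fin 4 → ℝ} (hz : z ∈ kundtDomain Ω) :
    cpd 2 (cpd 2 (lift φ)) z + cpd 3 (cpd 3 (lift φ)) z = 0 := by
  have hM := isOpen_kundtDomain hΩ
  set F : (Fin 4 → ℝ) → ℝ := fun w => φ (w 0, w 2, w 3) with hF
  have hFs : ContDiffOn ℝ ∞ F (kundtDomain Ω) := contDiffOn_kundtProj hφ
  have hpdF : ∀ i, ContDiffOn ℝ ∞ (pd i F) (kundtDomain Ω) := fun i =>
    (hFs.fderiv_of_isOpen hM (by simp)).clm_apply contDiffOn_const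
  have hd : ∀ {G : (Fin 4 → ℝ) → ℝ}, ContDiffOn ℝ ∞ G (kundtDomain Ω) → ∀ w ∈ kundtDomain Ω,
      DifferentiableAt ℝ G w := fun hG w hw =>
    (hG.contDiffAt (hM.mem_nhds hw)).differentiableAt (by simp)
  set ι := transverseEmbed (z 0) (z 1) with hι
  set U := ι ⁻¹' kundtDomain Ω with hU
  have hUo : IsOpen U := hM.preimage (contDiff_transverseEmbed _ _).continuous
  have hzι : ι ![z 2, z 3] = z := by
    ext i; fin_cases i <;> simp [hι, transverseEmbed]
  have hzU : ![z 2, z 3] ∈ U := by rw [hU, Set.mem_preimage, hzι]; exact hz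
  have h2 : ∀ i, pd i (pd i fun w => φ (z 0, w 0, w 1)) ![z 2, z 3]
      = pd (Fin.natAdd 2 i) (pd (Fin.natAdd 2 i) F) z := fun i => by
    refine (pd_congr (f := pd i fun w => φ (z 0, w 0, w 1))
      (g := fun w => pd (Fin.natAdd 2 i) F (ι w)) hUo hzU (fun w hw =>
        pd_comp_transverseEmbed (hd hFs _ hw) i) i).trans ?_
    rw [pd_comp_transverseEmbed (hd (hpdF _) _ hzU) i]
    exact congrArg _ hzι
  have hb := hbox _ _ _ hz
  rw [transverseBox_eq hUo (fun w hw => hP _ _ _ hw) hzU, h2, h2, neg_eq_zero, mul_eq_zero] at hb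
  have hb' := hb.resolve_left (pow_ne_zero 2 (hP _ _ _ hz))
  have hc : ∀ i, cpd i (cpd i (lift φ)) z = (pd i (pd i F) z : ℂ) := fun i => by
    rw [cpd_congr (f := cpd i (lift φ)) (g := fun w => (pd i F w : ℂ)) hM hz
      (fun w hw => cpd_ofReal i (hd hFs w hw)) i,
      cpd_ofReal i (hd (hpdF i) z hz)]
  rw [hc, hc]
  exact_mod_cast hb'

end Harmonic

/-! ### Balanced two-forms are closed -/

section Closed

variable {l k : ℝ} {Ω : Set (ℝ × ℝ × ℝ)} {H φ : ℝ × ℝ × ℝ → ℝ}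

theorem hodge_eq_contract (g : MetricField 4) (T : TensorField 4 (1 + 1)) :
    hodge (show 1 + 1 + 2 = 4 from rfl) g T = fun x b => (1 / 2 : ℝ) *
      contract g (contract g (k := 4) fun x (a : Fin 6 → Fin 4) =>
        tensorMul T (volumeTensor g) x (a ∘ Equiv.swap (1 : Fin 6) 2)) x b := by
  funext x b
  have h : ∀ (c d : Fin 4) (e : Fin 0 → Fin 4),
      (Fin.cons c (Fin.cons d e : Fin 1 → Fin 4) : Fin 2 → Fin 4) = ![c, d] := fun c d e => by
    ext i; fin_cases i <;> rfl
  have hsum : ∀ F : (Fin 2 → Fin 4) → ℝ, ∑ a, F a = ∑ c, ∑ d, F ![c, d] := fun F => by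
    simp only [sum_fin_cons, Fintype.sum_unique]
    exact Finset.sum_congr rfl fun c _ => Finset.sum_congr rfl fun d _ => congrArg F (h _ _ _)
  have hX : ∀ c d c' d' : Fin 4,
      tensorMul T (volumeTensor g) x ((Fin.cons c' (Fin.cons d' (Fin.cons c (Fin.cons d b :
          Fin 3 → Fin 4) : Fin 4 → Fin 4) : Fin 5 → Fin 4) : Fin 6 → Fin 4) ∘
          Equiv.swap (1 : Fin 6) 2)
        = T x ![c', c] * volumeTensor g x
          (fun i => Fin.append ![d', d] b (Fin.cast (show 1 + 1 + 2 = 4 from rfl).symm i)) := by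
    intro c d c' d'
    rw [tensorMul]
    congr 2
    · ext i; fin_cases i <;> rfl
    · ext i; fin_cases i <;> rfl
  have hprod : ∀ F : Fin (1 + 1) → ℝ, ∏ i, F i = F 0 * F 1 := Fin.prod_univ_two
  simp only [hodge, hsum, contract, hX, hprod]
  simp only [Matrix.cons_val_zero, Matrix.cons_val_one, Finset.mul_sum]
  norm_num
  -- The summation variables of the left side are `c'`, `c`, `d'`, `d` of `hX`, in this order.
  rw [Finset.sum_comm]
  refine Finset.sum_congr rfl fun c _ => ?_
  rw [Finset.sum_congr rfl fun c' _ => Finset.sum_comm]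
  rw [Finset.sum_comm]
  exact Finset.sum_congr rfl fun d _ => Finset.sum_congr rfl fun c' _ =>
    Finset.sum_congr rfl fun d' _ => by ring

theorem Balanced.hodge (hP : ∀ z ∈ kundtDomain Ω, kundtP k (z 2) (z 3) ≠ 0)
    (hΦ : ∀ s, RIndep (kundtDomain Ω) (potentials k (lift φ) s))
    {T : TensorField 4 (1 + 1)} (hT : Balanced l k Ω H φ T) :
    Balanced l k Ω H φ
      (EMField.hodge (show 1 + 1 + 2 = 4 from rfl) (kundtMetric l k H) T) := by
  rw [hodge_eq_contract]
  have h1 := (hT.tensorMul hΦ (balanced_volume (l := l) (H := H) hP)).relabel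
    (Equiv.swap (1 : Fin 6) 2)
  have h2 := (Balanced.contract (m := 4) hP h1).contract (m := 2) hP
  exact h2.smul_of_const (f := fun _ => 1 / 2) (c := 1 / 2) fun _ _ => rfl

theorem hodge_swap (g : MetricField 4) (T : TensorField 4 (1 + 1)) (x : Fin 4 → ℝ)
    (i j : Fin 4) :
    hodge (show 1 + 1 + 2 = 4 from rfl) g T x ![j, i]
      = -hodge (show 1 + 1 + 2 = 4 from rfl) g T x ![i, j] := by
  have hv : ∀ c : Fin 2 → Fin 4,
      volumeTensor g x
          (fun m => Fin.append c ![j, i] (Fin.cast (show 1 + 1 + 2 = 4 from rfl).symm m))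
        = -volumeTensor g x
          (fun m => Fin.append c ![i, j] (Fin.cast (show 1 + 1 + 2 = 4 from rfl).symm m)) := by
    intro c
    set a : Fin 4 → Fin 4 :=
      fun m => Fin.append c ![i, j] (Fin.cast (show 1 + 1 + 2 = 4 from rfl).symm m) with ha
    have hs : (fun m => Fin.append c ![j, i] (Fin.cast (show 1 + 1 + 2 = 4 from rfl).symm m))
        = a ∘ Equiv.swap (2 : Fin 4) 3 := by
      ext m; fin_cases m <;> rfl
    have hdet := Matrix.det_permute (Equiv.swap (2 : Fin 4) 3)
      (Matrix.of fun i j : Fin 4 => if a i = j then (1 : ℝ) else 0)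
    rw [hs, volumeTensor, volumeTensor]
    have hm : (Matrix.of fun i j : Fin 4 =>
        if (a ∘ Equiv.swap (2 : Fin 4) 3) i = j then (1 : ℝ) else 0)
        = (Matrix.of fun i j : Fin 4 => if a i = j then (1 : ℝ) else 0).submatrix
          (Equiv.swap (2 : Fin 4) 3) id := rfl
    rw [hm, hdet, Equiv.Perm.sign_swap (by decide)]
    simp
  simp only [EMField.hodge, hv, mul_neg, neg_mul, Finset.sum_neg_distrib]

theorem extD_two (S : TensorField 4 2) (x : Fin 4 → ℝ) (a : Fin 3 → Fin 4) :
    extD S x a = pd (a 0) (fun y => S y ![a 1, a 2]) x - pd (a 1) (fun y => S y ![a 0, a 2]) x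
      + pd (a 2) (fun y => S y ![a 0, a 1]) x := by
  have h0 : (fun j : Fin 2 => a ((0 : Fin 3).succAbove j)) = ![a 1, a 2] := by
    ext j; fin_cases j <;> rfl
  have h1 : (fun j : Fin 2 => a ((1 : Fin 3).succAbove j)) = ![a 0, a 2] := by
    ext j; fin_cases j <;> rfl
  have h2 : (fun j : Fin 2 => a ((2 : Fin 3).succAbove j)) = ![a 0, a 1] := by
    ext j; fin_cases j <;> rfl
  calc extD S x a
      = (-1) ^ 0 * pd (a 0) (fun y => S y fun j : Fin 2 => a ((0 : Fin 3).succAbove j)) x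
        + (-1) ^ 1 * pd (a 1) (fun y => S y fun j : Fin 2 => a ((1 : Fin 3).succAbove j)) x
        + (-1) ^ 2 * pd (a 2) (fun y => S y fun j : Fin 2 => a ((2 : Fin 3).succAbove j)) x :=
        Fin.sum_univ_three _
    _ = _ := by rw [h0, h1, h2]; ring

/-- A balanced two-form is `α du ∧ dr + β P⁻² dx ∧ dy + du ∧ ω` with constants `α`, `β`, where `ω`
is a combination with constant coefficients of `dφ` and of its transverse dual. It is closed because
`φ` is harmonic. -/
theorem Balanced.extD_eq_zero (hΩ : IsOpen Ω) (hH : ContDiffOn ℝ ∞ H Ω)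
    (hP : ∀ z ∈ kundtDomain Ω, kundtP k (z 2) (z 3) ≠ 0) (hφ : ContDiffOn ℝ ∞ φ Ω)
    (hharm : ∀ z ∈ kundtDomain Ω,
      cpd 2 (cpd 2 (lift φ)) z + cpd 3 (cpd 3 (lift φ)) z = 0)
    {S : TensorField 4 2} (hS : Balanced l k Ω H φ S)
    (hanti : ∀ z ∈ kundtDomain Ω, ∀ i j, S z ![j, i] = -S z ![i, j])
    {z : Fin 4 → ℝ} (hz : z ∈ kundtDomain Ω) (a : Fin 3 → Fin 4) : extD S z a = 0 := by
  have hM := isOpen_kundtDomain hΩ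
  have hΦ : ∀ s, RIndep (kundtDomain Ω) (potentials k (lift φ) s) := fun s =>
    rIndep_potentials hM (rIndep_lift hφ) s
  have hLs := (rIndep_lift hφ)
  set L := lift φ with hL
  have hdiag : ∀ w ∈ kundtDomain Ω, ∀ i, S w ![i, i] = 0 := fun w hw i => by
    have := hanti w hw i i; linarith
  have hPc : ∀ w ∈ kundtDomain Ω, (kundtP k (w 2) (w 3) : ℂ) ≠ 0 := fun w hw => by
    exact_mod_cast hP w hw
  have hcomp : ∀ (w : Fin 4 → ℝ) (A B : Fin 4), comp (kundtFrame l k H) S ![A, B] w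
      = ∑ c, ∑ d, kundtFrame l k H w A c * kundtFrame l k H w B d * (S w ![c, d] : ℂ) :=
    fun w A B => comp_rank_two S ![A, B] w
  obtain ⟨α, -, hα⟩ := (hS ![0, 1]).2.1 (by simp [levelWt])
  obtain ⟨β, -, hβ⟩ := (hS ![2, 3]).2.1 (by simp [levelWt])
  obtain ⟨γ, q, hq, hγ⟩ := (hS ![0, 2]).2.2 0 (by simp [levelWt])
  have h12 := (hS ![1, 2]).1 (by simp [levelWt])
  have h13 := (hS ![1, 3]).1 (by simp [levelWt])
  -- The coordinate components of `S` on the domain.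
  have c12 : ∀ w ∈ kundtDomain Ω, (S w ![1, 2] : ℂ) = 0 := fun w hw => by
    have e2 := h12 w hw
    have e3 := h13 w hw
    rw [hcomp] at e2 e3
    simp [kundtFrame, Fin.sum_univ_four] at e2 e3
    have : (kundtP k (w 2) (w 3) : ℂ) * (2 * (S w ![1, 2] : ℂ)) = 0 := by
      linear_combination e2 + e3
    simpa [hPc w hw] using this
  have c13 : ∀ w ∈ kundtDomain Ω, (S w ![1, 3] : ℂ) = 0 := fun w hw => by
    have e2 := h12 w hw
    rw [hcomp] at e2
    simp [kundtFrame, Fin.sum_univ_four] at e2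
    rw [c12 w hw] at e2
    simpa [hPc w hw] using e2
  have c01 : ∀ w ∈ kundtDomain Ω, (S w ![0, 1] : ℂ) = α := fun w hw => by
    have e := hα w hw
    rw [hcomp] at e
    simpa [kundtFrame, Fin.sum_univ_four, hdiag w hw] using e
  have c23 : ∀ w ∈ kundtDomain Ω, (kundtP k (w 2) (w 3) : ℂ) * (kundtP k (w 2) (w 3) : ℂ)
      * (S w ![2, 3] : ℂ) = β / (2 * Complex.I) := fun w hw => by
    have e := hβ w hw
    rw [hcomp] at e
    have e32 : (S w ![3, 2] : ℂ) = -(S w ![2, 3] : ℂ) := by rw [hanti w hw 2 3]; simp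
    simp [kundtFrame, Fin.sum_univ_four, hdiag w hw, e32] at e
    rw [eq_div_iff (by simp), ← e]
    ring
  have c0 : ∀ w ∈ kundtDomain Ω, (S w ![0, 2] : ℂ) - Complex.I * (S w ![0, 3] : ℂ)
      = γ * (cpd 2 L w - Complex.I * cpd 3 L w) := fun w hw => by
    have e := hγ w hw
    rw [hcomp, hq.eq_zero w hw] at e
    simp [kundtFrame, Fin.sum_univ_four, c12 w hw, c13 w hw, spinWt, potentials, potential,
      nullD] at e
    have := hPc w hw
    apply mul_left_cancel₀ this
    linear_combination e
  have hreal : ∀ w ∈ kundtDomain Ω, ∀ i, ∃ t : ℝ, cpd i L w = t := fun w hw i =>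
    ⟨_, cpd_ofReal i ((contDiffOn_kundtProj hφ).contDiffAt (hM.mem_nhds hw)
      |>.differentiableAt (by simp))⟩
  have c0' : ∀ w ∈ kundtDomain Ω, (S w ![0, 2] : ℂ) = γ.re * cpd 2 L w + γ.im * cpd 3 L w ∧
      (S w ![0, 3] : ℂ) = γ.re * cpd 3 L w - γ.im * cpd 2 L w := fun w hw => by
    obtain ⟨s, hs⟩ := hreal w hw 2
    obtain ⟨t, ht⟩ := hreal w hw 3
    have e := c0 w hw
    rw [hs, ht] at e ⊢
    have er := congrArg Complex.re e
    have ei := congrArg Complex.im e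
    simp at er ei
    constructor
    · have : S w ![0, 2] = γ.re * s + γ.im * t := by linarith
      rw [this]; push_cast; ring
    · have : S w ![0, 3] = γ.re * t - γ.im * s := by linarith
      rw [this]; push_cast; ring
  -- Their derivatives.
  have hSd : ∀ i j, DifferentiableAt ℝ (fun w => (S w ![i, j] : ℂ)) z := fun i j =>
    Complex.ofRealCLM.differentiableAt.comp z (hS.differentiableAt hΩ hH hP hΦ hz ![i, j])
  set D : Fin 4 → Fin 4 → Fin 4 → ℂ := fun i c d => cpd i (fun w => (S w ![c, d] : ℂ)) z with hD
  have D_anti : ∀ i c d, D i d c = -D i c d := fun i c d => by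
    have : D i d c = cpd i (fun w => (-1 : ℂ) * (S w ![c, d] : ℂ)) z :=
      cpd_congr hM hz (fun w hw => by rw [hanti w hw c d]; simp) i
    rw [this, cpd_const_mul _ _ (hSd c d)]; simp [hD]
  have D_diag : ∀ i c, D i c c = 0 := fun i c => by
    have := D_anti i c c
    linear_combination this / 2
  have D01 : ∀ i, D i 0 1 = 0 := fun i => by
    simp only [hD]; rw [cpd_congr hM hz c01, cpd_const]
  have D12 : ∀ i, D i 1 2 = 0 := fun i => by
    simp only [hD]; rw [cpd_congr hM hz c12, cpd_const]
  have D13 : ∀ i, D i 1 3 = 0 := fun i => by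
    simp only [hD]; rw [cpd_congr hM hz c13, cpd_const]
  have d2 := hLs.cpd hM 2
  have d3 := hLs.cpd hM 3
  have d2' := d2.1.differentiableAt_of_isOpen hM hz
  have d3' := d3.1.differentiableAt_of_isOpen hM hz
  have D02 : ∀ i, D i 0 2 = γ.re * cpd i (cpd 2 L) z + γ.im * cpd i (cpd 3 L) z := fun i => by
    simp only [hD]
    rw [cpd_congr hM hz fun w hw => (c0' w hw).1, cpd_add _ (d2'.const_mul _) (d3'.const_mul _),
      cpd_const_mul _ _ d2', cpd_const_mul _ _ d3']
  have D03 : ∀ i, D i 0 3 = γ.re * cpd i (cpd 3 L) z - γ.im * cpd i (cpd 2 L) z := fun i => by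
    simp only [hD]
    rw [cpd_congr hM hz fun w hw => (c0' w hw).2, cpd_sub _ (d3'.const_mul _) (d2'.const_mul _),
      cpd_const_mul _ _ d2', cpd_const_mul _ _ d3']
  have D102 : D 1 0 2 = 0 := by rw [D02, d2.cpd_one, d3.cpd_one]; simp
  have D103 : D 1 0 3 = 0 := by rw [D03, d2.cpd_one, d3.cpd_one]; simp
  have D203 : D 2 0 3 = D 3 0 2 := by
    rw [D03, D02, cpd_comm hM hLs.1 hz 3 2]
    linear_combination (-(γ.im : ℂ)) * hharm z hz
  have D23 : ∀ i, i = 0 ∨ i = 1 → D i 2 3 = 0 := fun i hi => by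
    have dP := (rIndep_kundtP (M := kundtDomain Ω) (k := k)).1.differentiableAt_of_isOpen hM hz
    have hPi : cpd i (fun z => (kundtP k (z 2) (z 3) : ℂ)) z = 0 := by
      rw [cpd_kundtP]; rcases hi with rfl | rfl <;> simp
    have e : cpd i (fun w => (kundtP k (w 2) (w 3) : ℂ) * (kundtP k (w 2) (w 3) : ℂ)
      * (S w ![2, 3] : ℂ)) z = 0 := by rw [cpd_congr hM hz c23, cpd_const]
    rw [cpd_mul _ (dP.fun_mul dP) (hSd 2 3), cpd_mul _ dP dP, hPi] at e
    simpa [hPc z hz] using e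
  have D023 := D23 0 (Or.inl rfl)
  have D123 := D23 1 (Or.inr rfl)
  have hpd : ∀ i c d, ((pd i (fun y => S y ![c, d]) z : ℝ) : ℂ) = D i c d := fun i c d =>
    (cpd_ofReal i (hS.differentiableAt hΩ hH hP hΦ hz ![c, d])).symm
  have hgoal : ((extD S z a : ℝ) : ℂ) = 0 := by
    rw [extD_two]
    push_cast
    rw [hpd, hpd, hpd]
    have e10 := fun i => D_anti i 0 1
    have e20 := fun i => D_anti i 0 2
    have e30 := fun i => D_anti i 0 3
    have e21 := fun i => D_anti i 1 2
    have e31 := fun i => D_anti i 1 3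
    have e32 := fun i => D_anti i 2 3
    generalize a 0 = p
    generalize a 1 = q
    generalize a 2 = r
    clear_value D
    fin_cases p <;> fin_cases q <;> fin_cases r <;>
      simp [D_diag, D01, D12, D13, D102, D103, D203, D023, D123, e10, e20, e30, e21, e31, e32]
  exact_mod_cast hgoal

theorem isForm_two {n : ℕ} {M : Set (Fin n → ℝ)} {S : TensorField n 2}
    (hanti : ∀ z ∈ M, ∀ i j, S z ![j, i] = -S z ![i, j]) : IsForm M S := by
  intro z hz σ a
  obtain ⟨i, j, rfl⟩ : ∃ i j, a = ![i, j] := ⟨a 0, a 1, by ext i; fin_cases i <;> rfl⟩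
  have hσ : σ = 1 ∨ σ = Equiv.swap 0 1 := by revert σ; decide
  rcases hσ with rfl | rfl
  · simp
  · have h : (![i, j] : Fin 2 → Fin n) ∘ Equiv.swap 0 1 = ![j, i] := by
      ext m; fin_cases m <;> rfl
    rw [h, hanti z hz]
    simp

end Closed

end EMField

end

open EMField

theorem proposition2p9 (a b k l : ℝ) (Ω : Set (ℝ × ℝ × ℝ)) (hΩ : IsOpen Ω)
    (hP : ∀ u x y : ℝ, (u, x, y) ∈ Ω → EMField.kundtP k x y ≠ 0)
    (H φ : ℝ × ℝ × ℝ → ℝ) (hH : ContDiffOn ℝ ∞ H Ω) (hφ : ContDiffOn ℝ ∞ φ Ω)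
    (hbox : ∀ u x y : ℝ, (u, x, y) ∈ Ω →
      EMField.transverseBox k (fun z => φ (u, z 0, z 1)) ![x, y] = 0) :
    EMField.IsUniversal (show 1 + 1 + 2 = 4 from rfl) (EMField.kundtMetric l k H)
      (EMField.kundtDomain Ω) (EMField.kundtForm a b k φ) := by
  have hP' : ∀ z ∈ kundtDomain Ω, kundtP k (z 2) (z 3) ≠ 0 := fun z hz => hP _ _ _ hz
  have hharm : ∀ z ∈ kundtDomain Ω,
      cpd 2 (cpd 2 (lift φ)) z + cpd 3 (cpd 3 (lift φ)) z = 0 := fun z hz =>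
    harmonic_lift hΩ hP hφ hbox hz
  have hΦ : ∀ s, RIndep (kundtDomain Ω) (potentials k (lift φ) s) := fun s =>
    rIndep_potentials (isOpen_kundtDomain hΩ) (rIndep_lift hφ) s
  have hanti : ∀ z ∈ kundtDomain Ω, ∀ i j,
      kundtForm a b k φ z ![j, i] = -kundtForm a b k φ z ![i, j] := fun z hz i j => by
    rw [kundtForm_apply hΩ hφ hz, kundtForm_apply hΩ hφ hz]
    fin_cases i <;> fin_cases j <;> simp
  refine ⟨isForm_two hanti, fun z hz c => ?_, fun T hT _ z hz c => ?_⟩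
  · exact (balanced_kundtForm (l := l) (H := H) hΩ hP' hφ a b).extD_eq_zero hΩ hH hP' hφ hharm
      hanti hz c
  · have hS := (hT.balanced hΩ hH hP' hφ hharm).hodge hP' hΦ
    have hd := hS.extD_eq_zero hΩ hH hP' hφ hharm (fun w _ i j => hodge_swap _ T w i j) hz
    rw [hodge]
    simp [hd]
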